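/- A Littlewood polynomial is a polynomial $P(z)=\sum_{j=0}^{n}a_jz^j$ with $a_j\in\{-1,1\}$ for all $0\le j\le n$ (so that $P$ has degree exactly $n$). **Theorem 1.1.** There exist absolute constants $\eta_2>\eta_1>0$ and a sequence $(P_n)$ of Littlewood polynomials, $P_n$ of degree $n$, such that for every integer $n\ge 2$ $$\eta_1\sqrt{n}\le |P_n(z)|\le \eta_2\sqrt{n}\qquad\text{for all } z\in\mathbb{C} \text{ with } |z|=1.$$ -/

import Mathlib

/-- A Littlewood polynomial: every coefficient, from the constant term up to the leading one,
is `1` or `-1`. (The zero polynomial is not one, since its constant term is `0`.) -/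
def IsLittlewood (P : Polynomial ℂ) : Prop :=
  ∀ j : ℕ, j ≤ P.natDegree → P.coeff j = 1 ∨ P.coeff j = -1

/-!
Write a polynomial of degree `4L` on the unit circle as `z ^ (2L)` times a trigonometric polynomial.
If the coefficients at distance `k` from the middle are equal for `k ∈ S` and opposite for `k ∉ S`,
then `P (exp (iθ)) = exp (2iLθ) (1 + 2 c(θ) + 2i s(θ))`, where `c` is a cosine polynomial with
frequencies in `S`, `s` is a sine polynomial with the remaining frequencies, and both have
coefficients `±1` (`polySum_symmCoeff`). Both parts being real, `|P|` is of order `√L` as soon as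
`c` and `s` are `O(√L)` and are never both small (`exists_flat_cos_sin`).

The cosine part is `Re (w ^ a P(w) + w ^ (2a) Q(w))` with `w = exp (2iθ)`, where `(P, Q)` is a
Rudin–Shapiro pair of length `D` and `a` is a large multiple of `D`. Since `|P|² + |Q|² = 2D` and
`P`, `Q` are nearly constant at the scale `1 / a`, the cosine part is there close to
`Re (p v + q v²)` with `v = w ^ a`, and by Lagrange interpolation it cannot be small at five
separated points of a short window (`not_five_separated_small`). Hence the cells of length
`1 / (2L)` on which it is small fall into blocks of bounded size that are far apart, and the number
of blocks is a small multiple of `L` (`exists_blocks`).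

The sine part imitates a signed sum of bumps of height `K√L`, one at each bad cell, with a sign that
is constant on each block. The bumps are translates of a Fejér kernel that uses odd frequencies only,
while all cosine frequencies are even, so the sum is a sine polynomial in the available frequencies.
Bumps of one block do not cancel, distant blocks interact weakly, and so the sum has size at least
`K√L / 16` on the bad cells (`le_sum_oddBump`). As there are few blocks, their signs can be chosen
such that all coefficients lie in `[-1, 1]` (`exists_block_signs`). These are finally rounded to `±1`
with a uniform error `O(√L)`, which is smaller than `K√L / 16` for large `K`
(`exists_sine_rounding`).

Both choices of signs rest on the partial colouring method (`exists_colouring`, `exists_rounding`):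
`s` vectors with `m ≥ s` coordinates in `[-1, 1]` have a signed sum of size `O((ms)^{1/4})`. The
uniform bound on the circle follows from one at `O(L)` roots of unity
(`norm_eval_le_of_roots_of_unity`). The finitely many remaining degrees are served by
`z ^ n + ⋯ + z - 1`, which has no zero on the circle.
-/

/-! ### Discrepancy: partial colourings -/

/-- The sign vector `±1` whose positive coordinates are those in `X`. -/
noncomputable def signOf {ι : Type*} (X : Finset ι) (i : ι) : ℝ :=
  open Classical in if i ∈ X then 1 else -1

theorem sum_exp_signOf_le {ι : Type*} (A : Finset ι) (v : ι → ℝ)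
    (hv : ∀ i ∈ A, |v i| ≤ 1) (t : ℝ) :
    ∑ X ∈ A.powerset, Real.exp (t * ∑ i ∈ A, v i * signOf X i) ≤
      2 ^ A.card * Real.exp (t ^ 2 * A.card / 2) := by
  classical
  have h1 : ∀ X ∈ A.powerset, Real.exp (t * ∑ i ∈ A, v i * signOf X i) =
      (∏ i ∈ X, Real.exp (t * v i)) * ∏ i ∈ A \ X, Real.exp (-(t * v i)) := by
    intro X hX
    rw [Finset.mem_powerset] at hX
    rw [Finset.mul_sum, Real.exp_sum, ← Finset.prod_sdiff hX, mul_comm]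
    congr 1
    · refine Finset.prod_congr rfl fun i hi => ?_
      simp [signOf, hi]
    · refine Finset.prod_congr rfl fun i hi => ?_
      simp [signOf, (Finset.mem_sdiff.1 hi).2]
  rw [Finset.sum_congr rfl h1, ← Finset.prod_add]
  have h2 : ∀ i ∈ A, Real.exp (t * v i) + Real.exp (-(t * v i)) ≤ 2 * Real.exp (t ^ 2 / 2) := by
    intro i hi
    have := Real.cosh_le_exp_half_sq (t * v i)
    rw [Real.cosh_eq] at this
    have h3 : Real.exp ((t * v i) ^ 2 / 2) ≤ Real.exp (t ^ 2 / 2) := by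
      apply Real.exp_le_exp.2
      have := (sq_le_one_iff_abs_le_one (v i)).2 (hv i hi)
      nlinarith [sq_nonneg t]
    linarith
  refine (Finset.prod_le_prod (fun i _ => by positivity) h2).trans (le_of_eq ?_)
  rw [Finset.prod_const, mul_pow, ← Real.exp_nat_mul]
  congr 2
  ring

theorem abs_round_le_exp {μ : ℝ} (hμ : 2 ≤ μ) (y : ℝ) :
    |(round y : ℝ)| ≤ Real.exp (-μ / 2) * (Real.exp (μ * y) + Real.exp (-μ * y)) := by
  by_cases h0 : round y = 0
  · rw [h0]; simp; positivity
  have hint : (1 : ℝ) ≤ |(round y : ℝ)| := by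
    have : (1 : ℤ) ≤ |round y| := Int.one_le_abs h0
    exact_mod_cast this
  have hr := abs_sub_round y
  have hle : |(round y : ℝ)| ≤ |y| + 1 / 2 := by
    have := abs_sub_abs_le_abs_sub (round y : ℝ) y
    rw [abs_sub_comm] at this
    linarith
  have hy : 1 / 2 ≤ |y| := by linarith
  have h2 : |(round y : ℝ)| ≤ 2 * |y| := by linarith
  have h3 : 2 * |y| ≤ Real.exp (μ * (|y| - 1 / 2)) := by
    have := Real.add_one_le_exp (μ * (|y| - 1 / 2))
    nlinarith
  have h4 : Real.exp (μ * |y|) ≤ Real.exp (μ * y) + Real.exp (-μ * y) := by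
    rcases abs_cases y with ⟨h, _⟩ | ⟨h, _⟩
    · rw [h]; linarith [Real.exp_pos (-μ * y)]
    · rw [h, show μ * -y = -μ * y by ring]; linarith [Real.exp_pos (μ * y)]
  calc |(round y : ℝ)| ≤ Real.exp (μ * (|y| - 1 / 2)) := h2.trans h3
    _ = Real.exp (-μ / 2) * Real.exp (μ * |y|) := by rw [← Real.exp_add]; ring_nf
    _ ≤ _ := by gcongr

theorem sum_Icc_pow_natAbs_le {q : ℝ} (hq0 : 0 ≤ q) (hq : q ≤ 1 / 2) (B : ℕ) :
    ∑ b ∈ Finset.Icc (-(B : ℤ)) B, q ^ b.natAbs ≤ 1 + 4 * q - 4 * q ^ (B + 1) := by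
  induction B with
  | zero => simp
  | succ B ih =>
    have h : Finset.Icc (-((B + 1 : ℕ) : ℤ)) ((B + 1 : ℕ) : ℤ) =
        insert ((B + 1 : ℕ) : ℤ) (insert (-((B + 1 : ℕ) : ℤ)) (Finset.Icc (-(B : ℤ)) B)) := by
      ext x; simp only [Finset.mem_Icc, Finset.mem_insert]; omega
    rw [h, Finset.sum_insert (by simp; omega), Finset.sum_insert (by simp)]
    have hp : 0 ≤ q ^ (B + 1) := by positivity
    simp only [Int.natAbs_neg, Int.natAbs_natCast]
    rw [pow_succ q (B + 1)]
    nlinarith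

/-- A Chernoff bound for counting: there are few integer vectors of small `ℓ¹` norm. -/
theorem card_le_of_sum_natAbs_le {κ : Type*} [Fintype κ] (S : Finset (κ → ℤ))
    {T lam : ℝ} (hlam : Real.exp (-lam) ≤ 1 / 2) (hlam0 : 0 ≤ lam)
    (hS : ∀ b ∈ S, ∑ k, |(b k : ℝ)| ≤ T) :
    (S.card : ℝ) ≤ Real.exp (lam * T + 4 * Fintype.card κ * Real.exp (-lam)) := by
  classical
  set q := Real.exp (-lam) with hq
  obtain ⟨B, hB⟩ : ∃ B : ℕ, ∀ b ∈ S, ∀ k, (b k).natAbs ≤ B := by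
    refine ⟨∑ b ∈ S, ∑ k, (b k).natAbs, fun b hb k => ?_⟩
    exact (Finset.single_le_sum (f := fun k => (b k).natAbs) (fun _ _ => Nat.zero_le _)
      (Finset.mem_univ k)).trans
      (Finset.single_le_sum (f := fun b : κ → ℤ => ∑ k, (b k).natAbs)
        (fun _ _ => Nat.zero_le _) hb)
  have h1 : ∀ b ∈ S, (1 : ℝ) ≤ Real.exp (lam * T) * ∏ k, q ^ (b k).natAbs := by
    intro b hb
    have : ∏ k, q ^ (b k).natAbs = Real.exp (-lam * ∑ k, |(b k : ℝ)|) := by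
      rw [Finset.mul_sum, Real.exp_sum]
      refine Finset.prod_congr rfl fun k _ => ?_
      rw [hq, ← Real.exp_nat_mul, Nat.cast_natAbs, Int.cast_abs]
      ring_nf
    rw [this, ← Real.exp_add]
    apply Real.one_le_exp
    have := mul_le_mul_of_nonneg_left (hS b hb) hlam0
    linarith
  have hsub : S ⊆ Fintype.piFinset fun _ : κ => Finset.Icc (-(B : ℤ)) B := by
    intro b hb
    rw [Fintype.mem_piFinset]
    intro k
    have := hB b hb k
    rw [Finset.mem_Icc]; omega
  have hq0 : 0 ≤ q := (Real.exp_pos _).le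
  calc (S.card : ℝ) = ∑ b ∈ S, (1 : ℝ) := by simp
    _ ≤ ∑ b ∈ S, Real.exp (lam * T) * ∏ k, q ^ (b k).natAbs := Finset.sum_le_sum h1
    _ ≤ ∑ b ∈ Fintype.piFinset fun _ : κ => Finset.Icc (-(B : ℤ)) B,
          Real.exp (lam * T) * ∏ k, q ^ (b k).natAbs :=
        Finset.sum_le_sum_of_subset_of_nonneg hsub fun _ _ _ => by positivity
    _ = Real.exp (lam * T) * ∏ _k : κ, ∑ b ∈ Finset.Icc (-(B : ℤ)) B, q ^ b.natAbs := by
        rw [← Finset.mul_sum, Finset.prod_univ_sum]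
    _ ≤ Real.exp (lam * T) * ∏ _k : κ, Real.exp (4 * q) := by
        gcongr with k
        have := sum_Icc_pow_natAbs_le hq0 hlam B
        have h2 := Real.add_one_le_exp (4 * q)
        have h3 : 0 ≤ q ^ (B + 1) := by positivity
        linarith
    _ = _ := by
        rw [Finset.prod_const, ← Real.exp_nat_mul, ← Real.exp_add, Finset.card_univ]
        ring_nf

/-- A family of subsets of `A` of pairwise small Hamming distance is small, since it lies in a
Hamming ball. -/
theorem card_le_of_card_symmDiff_le {ι : Type*} [DecidableEq ι] (A : Finset ι)
    (F : Finset (Finset ι)) (hFA : F ⊆ A.powerset)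
    (hF : ∀ X ∈ F, ∀ Y ∈ F, 20 * (symmDiff X Y).card ≤ A.card) :
    (F.card : ℝ) ≤ Real.exp (0.25 * A.card) := by
  rcases F.eq_empty_or_nonempty with rfl | ⟨X₀, hX₀⟩
  · simp; positivity
  have hinj : F.card = (F.image fun X => symmDiff X X₀).card := by
    rw [Finset.card_image_of_injective _ (symmDiff_left_injective X₀)]
  set G := F.image fun X => symmDiff X X₀ with hG
  have hGsub : G ⊆ A.powerset := by
    intro Y hY
    obtain ⟨X, hX, rfl⟩ := Finset.mem_image.1 hY
    have h1 := Finset.mem_powerset.1 (hFA hX)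
    have h2 := Finset.mem_powerset.1 (hFA hX₀)
    rw [Finset.mem_powerset]
    intro i hi
    rcases Finset.mem_symmDiff.1 hi with h | h
    · exact h1 h.1
    · exact h2 h.1
  have hGc : ∀ Y ∈ G, (1 : ℝ) ≤ Real.exp (0.1 * A.card) * Real.exp (-2) ^ Y.card := by
    intro Y hY
    obtain ⟨X, hX, rfl⟩ := Finset.mem_image.1 hY
    have h : (20 : ℝ) * (symmDiff X X₀).card ≤ A.card := by exact_mod_cast hF X hX X₀ hX₀
    rw [← Real.exp_nat_mul, ← Real.exp_add]
    apply Real.one_le_exp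
    linarith
  have he : Real.exp (-2) ≤ 0.15 := by
    have h1 := Real.exp_one_gt_d9
    rw [Real.exp_neg, show (2 : ℝ) = 1 + 1 by norm_num, Real.exp_add, inv_le_comm₀ (by positivity)
      (by norm_num)]
    norm_num at h1 ⊢
    nlinarith
  rw [hinj]
  calc (G.card : ℝ) = ∑ Y ∈ G, (1 : ℝ) := by simp
    _ ≤ ∑ Y ∈ G, Real.exp (0.1 * A.card) * Real.exp (-2) ^ Y.card := Finset.sum_le_sum hGc
    _ ≤ ∑ Y ∈ A.powerset, Real.exp (0.1 * A.card) * Real.exp (-2) ^ Y.card :=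
        Finset.sum_le_sum_of_subset_of_nonneg hGsub fun _ _ _ => by positivity
    _ = Real.exp (0.1 * A.card) * (Real.exp (-2) + 1) ^ A.card := by
        rw [← Finset.mul_sum]
        have := Finset.prod_add (fun _ => Real.exp (-2)) (fun _ => (1 : ℝ)) A
        simp only [Finset.prod_const, one_pow, mul_one] at this
        rw [this]
    _ ≤ Real.exp (0.1 * A.card) * Real.exp 0.15 ^ A.card := by
        gcongr
        linarith [Real.add_one_le_exp (0.15 : ℝ)]
    _ = _ := by rw [← Real.exp_nat_mul, ← Real.exp_add]; ring_nf

/-- Partial colouring by pigeonhole: two sign vectors whose discrepancies round to the same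
multiples of `Δ` and which differ in many coordinates. -/
theorem exists_signOf_close {ι κ : Type*} [DecidableEq ι] [Fintype κ] (A : Finset ι)
    (hA : 20 ≤ A.card) (hm : A.card ≤ Fintype.card κ) (V : κ → ι → ℝ)
    (hV : ∀ k, ∀ i ∈ A, |V k i| ≤ 1) :
    ∃ X ⊆ A, ∃ Y ⊆ A, A.card < 20 * (symmDiff X Y).card ∧
      ∀ k, |∑ i ∈ A, V k i * signOf X i - ∑ i ∈ A, V k i * signOf Y i| ≤
        √(160 * √(Fintype.card κ * A.card)) := by
  classical
  set s := (A.card : ℝ) with hs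
  set m := (Fintype.card κ : ℝ) with hmdef
  have hs20 : (20 : ℝ) ≤ s := by rw [hs]; exact_mod_cast hA
  have hsm : s ≤ m := by rw [hs, hmdef]; exact_mod_cast hm
  set ρ : ℝ := √(m / s) with hρ
  have hρ1 : 1 ≤ ρ := by
    rw [hρ, Real.one_le_sqrt, le_div_iff₀ (by linarith)]; linarith
  have hρ2 : s * ρ ^ 2 = m := by
    rw [hρ, Real.sq_sqrt (by positivity)]; field_simp
  have hsρ : √(m * s) = s * ρ := by
    rw [← hρ2, show s * ρ ^ 2 * s = (s * ρ) ^ 2 by ring, Real.sqrt_sq (by positivity)]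
  rw [hsρ]
  set Δ := √(160 * (s * ρ)) with hΔ
  have hΔ2 : Δ ^ 2 = 160 * (s * ρ) := Real.sq_sqrt (by positivity)
  have hΔ0 : 0 < Δ := Real.sqrt_pos.2 (by positivity)
  let D : Finset ι → κ → ℝ := fun X k => ∑ i ∈ A, V k i * signOf X i
  let b : Finset ι → κ → ℤ := fun X k => round (D X k / Δ)
  set μ := 80 * ρ with hμ
  -- The exponential moments of `D` bound the mean of `|b X k|`.
  have hmom : ∀ k, ∑ X ∈ A.powerset, |(b X k : ℝ)| ≤ 2 ^ A.card * (2 * Real.exp (-20 * ρ)) := by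
    intro k
    have hexp : ∀ t : ℝ, t ^ 2 = (μ / Δ) ^ 2 →
        ∑ X ∈ A.powerset, Real.exp (t * D X k) ≤ 2 ^ A.card * Real.exp (20 * ρ) := by
      intro t ht
      refine (sum_exp_signOf_le A (V k) (hV k) t).trans (le_of_eq ?_)
      congr 2
      rw [ht, div_pow, hΔ2, ← hs, hμ]
      field_simp
      ring
    calc ∑ X ∈ A.powerset, |(b X k : ℝ)|
        ≤ ∑ X ∈ A.powerset, Real.exp (-μ / 2) *
            (Real.exp ((μ / Δ) * D X k) + Real.exp ((-μ / Δ) * D X k)) := by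
          refine Finset.sum_le_sum fun X _ => ?_
          have := abs_round_le_exp (μ := μ) (by linarith) (D X k / Δ)
          rw [show μ / Δ * D X k = μ * (D X k / Δ) by ring,
            show -μ / Δ * D X k = -μ * (D X k / Δ) by ring]
          exact this
      _ ≤ Real.exp (-μ / 2) * (2 ^ A.card * Real.exp (20 * ρ) + 2 ^ A.card * Real.exp (20 * ρ)) := by
          rw [← Finset.mul_sum, Finset.sum_add_distrib]
          gcongr
          · exact hexp _ rfl
          · exact hexp _ (by ring)
      _ = 2 ^ A.card * (2 * (Real.exp (-μ / 2) * Real.exp (20 * ρ))) := by ring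
      _ = _ := by rw [← Real.exp_add, hμ]; ring_nf
  set T := 4 * m * Real.exp (-20 * ρ) with hT
  have hT0 : 0 < T := by rw [hT]; have : 0 < m := by linarith
                         positivity
  let G := A.powerset.filter fun X => ∑ k, |(b X k : ℝ)| ≤ T
  have hG : (2 : ℝ) ^ A.card / 2 ≤ G.card := by
    have htot : ∑ X ∈ A.powerset, ∑ k, |(b X k : ℝ)| ≤ 2 ^ A.card * (T / 2) := by
      rw [Finset.sum_comm]
      calc _ ≤ ∑ _k : κ, (2 : ℝ) ^ A.card * (2 * Real.exp (-20 * ρ)) :=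
            Finset.sum_le_sum fun k _ => hmom k
        _ = _ := by
            rw [Finset.sum_const, nsmul_eq_mul, Finset.card_univ, ← hmdef, hT]; ring
    have hbad : ((A.powerset.filter fun X => ¬ ∑ k, |(b X k : ℝ)| ≤ T).card : ℝ) * T ≤
        ∑ X ∈ A.powerset, ∑ k, |(b X k : ℝ)| := by
      calc _ = ∑ X ∈ A.powerset.filter fun X => ¬ ∑ k, |(b X k : ℝ)| ≤ T, T := by
            rw [Finset.sum_const, nsmul_eq_mul]
        _ ≤ ∑ X ∈ A.powerset.filter fun X => ¬ ∑ k, |(b X k : ℝ)| ≤ T, ∑ k, |(b X k : ℝ)| :=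
            Finset.sum_le_sum fun X hX => (not_le.1 (Finset.mem_filter.1 hX).2).le
        _ ≤ _ := Finset.sum_le_sum_of_subset_of_nonneg (Finset.filter_subset _ _)
            fun _ _ _ => Finset.sum_nonneg fun _ _ => abs_nonneg _
    have hsplit : (G.card : ℝ) + (A.powerset.filter fun X => ¬ ∑ k, |(b X k : ℝ)| ≤ T).card =
        2 ^ A.card := by
      have := Finset.card_filter_add_card_filter_not (s := A.powerset)
        (fun X => ∑ k, |(b X k : ℝ)| ≤ T)
      rw [Finset.card_powerset] at this
      have h := congrArg (Nat.cast : ℕ → ℝ) this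
      push_cast at h
      exact h
    have h2 : ((A.powerset.filter fun X => ¬ ∑ k, |(b X k : ℝ)| ≤ T).card : ℝ) ≤
        2 ^ A.card / 2 := by
      have := hbad.trans htot
      rw [show (2 : ℝ) ^ A.card * (T / 2) = (2 ^ A.card / 2) * T by ring] at this
      exact le_of_mul_le_mul_right this hT0
    linarith
  have himg : ((G.image b).card : ℝ) ≤ Real.exp (0.08 * s) := by
    have hl : Real.exp (-Real.log (100 * ρ ^ 2)) = 1 / (100 * ρ ^ 2) := by
      rw [Real.exp_neg, Real.exp_log (by positivity), one_div]
    refine (card_le_of_sum_natAbs_le (G.image b) (T := T) (lam := Real.log (100 * ρ ^ 2))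
      ?_ ?_ ?_).trans ?_
    · rw [hl, div_le_div_iff₀ (by positivity) (by positivity)]; nlinarith
    · exact Real.log_nonneg (by nlinarith)
    · intro c hc
      obtain ⟨X, hX, rfl⟩ := Finset.mem_image.1 hc
      exact (Finset.mem_filter.1 hX).2
    · apply Real.exp_le_exp.2
      rw [hl, ← hmdef]
      have h1 : 4 * m * (1 / (100 * ρ ^ 2)) = 0.04 * s := by
        rw [← hρ2]; field_simp; norm_num
      have h2 : Real.log (100 * ρ ^ 2) ≤ 100 * ρ ^ 2 := by
        have := Real.log_le_sub_one_of_pos (show 0 < 100 * ρ ^ 2 by positivity)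
        linarith
      have h3 : 10 * ρ ≤ Real.exp (5 * ρ) := by
        have := Real.two_mul_le_exp (x := 5 * ρ); linarith
      have h4 : (10 * ρ) ^ 4 ≤ Real.exp (20 * ρ) := by
        calc (10 * ρ) ^ 4 ≤ Real.exp (5 * ρ) ^ 4 := by gcongr
          _ = _ := by rw [← Real.exp_nat_mul]; norm_num; ring_nf
      have h5 : ρ ^ 4 * Real.exp (-20 * ρ) ≤ 1 / 10000 := by
        rw [show -20 * ρ = -(20 * ρ) by ring, Real.exp_neg, ← div_eq_mul_inv,
          div_le_iff₀ (Real.exp_pos _)]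
        nlinarith
      have h6 : Real.log (100 * ρ ^ 2) * T ≤ 0.04 * s := by
        calc _ ≤ 100 * ρ ^ 2 * T := by gcongr
          _ = 400 * s * (ρ ^ 4 * Real.exp (-20 * ρ)) := by rw [hT, ← hρ2]; ring
          _ ≤ 400 * s * (1 / 10000) := by gcongr
          _ = _ := by ring
      linarith
  by_contra hcon
  push Not at hcon
  have hfib : ∀ c ∈ G.image b, ((G.filter fun X => b X = c).card : ℝ) ≤ Real.exp (0.25 * s) := by
    intro c _
    refine card_le_of_card_symmDiff_le A _ ?_ ?_
    · intro X hX
      exact (Finset.mem_filter.1 (Finset.mem_filter.1 hX).1).1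
    · intro X hX Y hY
      by_contra hlt
      push Not at hlt
      obtain ⟨hX1, hX2⟩ := Finset.mem_filter.1 hX
      obtain ⟨hY1, hY2⟩ := Finset.mem_filter.1 hY
      obtain ⟨k, hk⟩ := hcon X (Finset.mem_powerset.1 (Finset.mem_filter.1 hX1).1) Y
        (Finset.mem_powerset.1 (Finset.mem_filter.1 hY1).1) hlt
      have hb : b X k = b Y k := by rw [hX2, hY2]
      have e1 := abs_sub_round (D X k / Δ)
      have e2 := abs_sub_round (D Y k / Δ)
      have e3 : |D X k / Δ - D Y k / Δ| ≤ 1 := by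
        have hb' : (round (D X k / Δ) : ℝ) = round (D Y k / Δ) := by exact_mod_cast hb
        rw [abs_le] at *
        constructor <;> linarith
      rw [← sub_div, abs_div, abs_of_pos hΔ0, div_le_one hΔ0] at e3
      exact absurd e3 (not_le.2 hk)
  have hcard : (G.card : ℝ) ≤ Real.exp (0.08 * s) * Real.exp (0.25 * s) := by
    calc (G.card : ℝ) = ∑ c ∈ G.image b, ((G.filter fun X => b X = c).card : ℝ) := by
          rw [Finset.card_eq_sum_card_image b G]; push_cast; rfl
      _ ≤ ∑ c ∈ G.image b, Real.exp (0.25 * s) := Finset.sum_le_sum hfib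
      _ = (G.image b).card * Real.exp (0.25 * s) := by rw [Finset.sum_const, nsmul_eq_mul]
      _ ≤ _ := by gcongr
  have hbig : Real.exp (0.08 * s) * Real.exp (0.25 * s) < (2 : ℝ) ^ A.card / 2 := by
    have h2 : (2 : ℝ) ^ A.card = Real.exp (s * Real.log 2) := by
      rw [hs, Real.exp_nat_mul, Real.exp_log (by norm_num)]
    have h3 : (2 : ℝ) = Real.exp (Real.log 2) := by rw [Real.exp_log (by norm_num)]
    have h4 : (2 : ℝ) ^ A.card / 2 = Real.exp (s * Real.log 2 - Real.log 2) := by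
      rw [Real.exp_sub, ← h3, h2]
    rw [h4, ← Real.exp_add]
    apply Real.exp_lt_exp.2
    have := Real.log_two_gt_d9
    nlinarith
  linarith

/-- The constant in the discrepancy bound. A partial colouring costs at most `13 / 2` times
`(ms)^{1/4}` and each round shrinks this quantity by the factor `0.9875`, so `6.5 / 0.0125 = 520`
would do. -/
noncomputable def discConst : ℝ := 1040

/-- Every set of coordinates has a colouring of discrepancy `O((ms)^{1/4})`: the errors of
repeated partial colourings form a geometric series. -/
theorem exists_colouring {ι κ : Type*} [Fintype κ] (V : κ → ι → ℝ) (hV : ∀ k i, |V k i| ≤ 1)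
    (A : Finset ι) (hm : A.card ≤ Fintype.card κ) :
    ∃ x : ι → ℝ, (∀ i, x i = 1 ∨ x i = -1) ∧
      ∀ k, |∑ i ∈ A, V k i * x i| ≤ discConst * √√(Fintype.card κ * A.card) := by
  classical
  induction h : A.card using Nat.strong_induction_on generalizing A with
  | _ n ih =>
  subst h
  set m := (Fintype.card κ : ℝ) with hmdef
  have hAm : (A.card : ℝ) ≤ m := by rw [hmdef]; exact_mod_cast hm
  by_cases h20 : A.card < 20
  · refine ⟨fun _ => 1, fun _ => Or.inl rfl, fun k => ?_⟩
    rcases Nat.eq_zero_or_pos A.card with h0 | h0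
    · rw [Finset.card_eq_zero] at h0; subst h0; simp
    have h1 : (1 : ℝ) ≤ A.card := by exact_mod_cast h0
    have h2 : |∑ i ∈ A, V k i * 1| ≤ 20 := by
      calc |∑ i ∈ A, V k i * 1| ≤ ∑ i ∈ A, |V k i * 1| := Finset.abs_sum_le_sum_abs _ _
        _ ≤ ∑ i ∈ A, (1 : ℝ) := Finset.sum_le_sum fun i _ => by rw [mul_one]; exact hV k i
        _ = A.card := by simp
        _ ≤ 20 := by exact_mod_cast h20.le
    have h3 : (1 : ℝ) ≤ √√(m * A.card) := by
      rw [Real.one_le_sqrt, Real.one_le_sqrt]; nlinarith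
    rw [discConst]; linarith
  obtain ⟨X, hX, Y, hY, hcard, hd⟩ := exists_signOf_close A (not_lt.1 h20) hm V fun k i _ => hV k i
  have hsub : symmDiff X Y ⊆ A := by
    intro i hi
    rcases Finset.mem_symmDiff.1 hi with h | h
    · exact hX h.1
    · exact hY h.1
  set B := A \ symmDiff X Y with hB
  have hBcard : B.card + (symmDiff X Y).card = A.card := Finset.card_sdiff_add_card_eq_card hsub
  obtain ⟨x, hx, hxd⟩ := ih B.card (by omega) B (by omega) rfl
  refine ⟨fun i => if i ∈ symmDiff X Y then signOf X i else x i, fun i => ?_, fun k => ?_⟩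
  · by_cases hi : i ∈ symmDiff X Y
    · simp only [if_pos hi, signOf]; split_ifs <;> simp
    · simp only [if_neg hi]; exact hx i
  have hsplit : ∑ i ∈ A, V k i * (if i ∈ symmDiff X Y then signOf X i else x i) =
      ∑ i ∈ B, V k i * x i + (∑ i ∈ A, V k i * signOf X i - ∑ i ∈ A, V k i * signOf Y i) / 2 := by
    rw [← Finset.sum_sdiff hsub]
    congr 1
    · refine Finset.sum_congr rfl fun i hi => ?_
      rw [if_neg (Finset.mem_sdiff.1 hi).2]
    · rw [← Finset.sum_sub_distrib, Finset.sum_div, ← Finset.sum_sdiff hsub]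
      have h0 : ∑ i ∈ A \ symmDiff X Y, (V k i * signOf X i - V k i * signOf Y i) / 2 = 0 := by
        refine Finset.sum_eq_zero fun i hi => ?_
        have : signOf X i = signOf Y i := by
          have := (Finset.mem_sdiff.1 hi).2
          rw [Finset.mem_symmDiff] at this
          unfold signOf
          split_ifs <;> tauto
        rw [this]; ring
      rw [h0, zero_add]
      refine Finset.sum_congr rfl fun i hi => ?_
      rw [if_pos hi]
      have : signOf Y i = -signOf X i := by
        rw [Finset.mem_symmDiff] at hi
        unfold signOf
        split_ifs <;> first | tauto | norm_num
      rw [this]; ring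
  rw [hsplit]
  set Q := √√(m * A.card) with hQ
  have hQ0 : 0 ≤ Q := Real.sqrt_nonneg _
  have h1 : √(160 * √(m * A.card)) ≤ 13 * Q := by
    rw [Real.sqrt_mul (by norm_num)]
    have : √160 ≤ 13 := by rw [Real.sqrt_le_left (by norm_num)]; norm_num
    gcongr
  -- `0.95 ≤ 0.9875 ^ 4`, so the error bound shrinks by the factor `0.9875` in each round.
  have h2 : √√(m * B.card) ≤ 0.9875 * Q := by
    have hb : (B.card : ℝ) ≤ 0.95 * A.card := by
      have e1 : (B.card : ℝ) + (symmDiff X Y).card = A.card := by exact_mod_cast hBcard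
      have e2 : (A.card : ℝ) < 20 * (symmDiff X Y).card := by exact_mod_cast hcard
      linarith
    have hm0 : 0 ≤ m := by rw [hmdef]; positivity
    rw [Real.sqrt_le_left (by positivity), Real.sqrt_le_left (by positivity)]
    have hQ4 : (Q ^ 2) ^ 2 = m * A.card := by
      rw [hQ, Real.sq_sqrt (Real.sqrt_nonneg _), Real.sq_sqrt (by positivity)]
    calc m * B.card ≤ m * (0.95 * A.card) := by gcongr
      _ = 0.95 * (m * A.card) := by ring
      _ ≤ 0.9875 ^ 4 * (Q ^ 2) ^ 2 := by
          rw [hQ4]; gcongr; norm_num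
      _ = _ := by ring
  have h3 := hxd k
  have h4 := hd k
  rw [abs_le] at *
  unfold discConst at *
  constructor <;> nlinarith

/-- Linear discrepancy: a point of the cube is close to a vertex. The doubled point `2x` is a
vertex plus a point of the cube; rounding the latter leaves a point of `{-1, 0, 1}^ι`, whose zero
coordinates are coloured. So the error `e` of the best rounding satisfies `e ≤ e / 2 + D`. -/
theorem exists_rounding {ι κ : Type*} [Fintype ι] [Fintype κ] (V : κ → ι → ℝ)
    (hV : ∀ k i, |V k i| ≤ 1) (hm : Fintype.card ι ≤ Fintype.card κ)
    (x : ι → ℝ) (hx : ∀ i, |x i| ≤ 1) :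
    ∃ ε : ι → ℝ, (∀ i, ε i = 1 ∨ ε i = -1) ∧
      ∀ k, |∑ i, V k i * (ε i - x i)| ≤
        3 * discConst * √√(Fintype.card κ * Fintype.card ι) := by
  classical
  set n := Fintype.card ι with hn
  set D := discConst * √√(Fintype.card κ * n) with hD
  have key : ∀ N : ℕ, ∀ x : ι → ℝ, (∀ i, |x i| ≤ 1) → ∃ ε : ι → ℝ, (∀ i, ε i = 1 ∨ ε i = -1) ∧
      ∀ k, |∑ i, V k i * (ε i - x i)| ≤ 2 * D + 2 * n / 2 ^ N := by
    intro N
    induction N with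
    | zero =>
      intro x hx
      refine ⟨fun _ => 1, fun _ => Or.inl rfl, fun k => ?_⟩
      have hD0 : 0 ≤ D := by rw [hD, discConst]; positivity
      calc |∑ i, V k i * (1 - x i)| ≤ ∑ i, |V k i * (1 - x i)| := Finset.abs_sum_le_sum_abs _ _
        _ ≤ ∑ _i : ι, (2 : ℝ) := by
            refine Finset.sum_le_sum fun i _ => ?_
            rw [abs_mul]
            have h1 := hV k i
            have h2 : |1 - x i| ≤ 2 := by
              have := abs_le.1 (hx i)
              rw [abs_le]; constructor <;> linarith
            calc |V k i| * |1 - x i| ≤ 1 * 2 := by gcongr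
              _ = 2 := by norm_num
        _ = 2 * n := by simp [hn, mul_comm]
        _ ≤ _ := by simp; linarith
    | succ N ih =>
      intro x hx
      let e : ι → ℝ := fun i => if 0 ≤ x i then 1 else -1
      have he : ∀ i, e i = 1 ∨ e i = -1 := fun i => by
        simp only [e]; split_ifs <;> simp
      obtain ⟨ε', hε', hd⟩ := ih (fun i => 2 * x i - e i) (fun i => by
        have := abs_le.1 (hx i)
        simp only [e]
        split_ifs with h
        · rw [abs_le]; constructor <;> linarith
        · rw [abs_le]; constructor <;> linarith)
      let A : Finset ι := Finset.univ.filter fun i => e i ≠ ε' i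
      have hA : A.card ≤ n := Finset.card_le_univ A
      obtain ⟨χ, hχ, hχd⟩ := exists_colouring V hV A (hA.trans hm)
      refine ⟨fun i => if e i ≠ ε' i then χ i else e i, fun i => ?_, fun k => ?_⟩
      · by_cases h : e i ≠ ε' i
        · simp only [if_pos h]; exact hχ i
        · simp only [if_neg h]; exact he i
      have hsum : ∑ i, V k i * ((if e i ≠ ε' i then χ i else e i) - x i) =
          ∑ i ∈ A, V k i * χ i + (∑ i, V k i * (ε' i - (2 * x i - e i))) / 2 := by
        rw [Finset.sum_filter, Finset.sum_div, ← Finset.sum_add_distrib]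
        refine Finset.sum_congr rfl fun i _ => ?_
        by_cases h : e i = ε' i
        · simp only [h, ne_eq, not_true_eq_false, if_false]; ring
        · simp only [h, ne_eq, not_false_eq_true, if_true]
          have : e i = -ε' i := by
            rcases he i with h1 | h1 <;> rcases hε' i with h2 | h2 <;>
              first | exact absurd (h1.trans h2.symm) h | simp [h1, h2]
          rw [this]; ring
      rw [hsum]
      have h1 : |∑ i ∈ A, V k i * χ i| ≤ D := by
        refine (hχd k).trans ?_
        rw [hD, discConst]
        gcongr
      have h2 := hd k
      have h3 : 2 * (n : ℝ) / 2 ^ (N + 1) = 2 * n / 2 ^ N / 2 := by rw [pow_succ]; field_simp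
      rw [h3]
      rw [abs_le] at *
      constructor <;> linarith
  obtain ⟨ε, hε, hd⟩ := key (n + 1) x hx
  refine ⟨ε, hε, fun k => ?_⟩
  rcases Nat.eq_zero_or_pos n with h0 | h0
  · have : IsEmpty ι := Fintype.card_eq_zero_iff.1 h0
    simp; rw [discConst]; positivity
  have hn1 : (1 : ℝ) ≤ n := by exact_mod_cast h0
  have hm1 : (1 : ℝ) ≤ Fintype.card κ := by exact_mod_cast h0.trans_le hm
  have hD1 : 1 ≤ D := by
    have : (1 : ℝ) ≤ √√(Fintype.card κ * n) := by
      rw [Real.one_le_sqrt, Real.one_le_sqrt]; nlinarith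
    rw [hD, discConst]; linarith
  have h2 : 2 * (n : ℝ) / 2 ^ (n + 1) ≤ 1 := by
    rw [div_le_one (by positivity), pow_succ]
    have : (n : ℝ) ≤ 2 ^ n := by exact_mod_cast n.lt_two_pow_self.le
    linarith
  have := hd k
  rw [mul_assoc, ← hD]
  linarith

/-! ### Sup norm of a polynomial from its values at roots of unity -/

theorem sum_pow_root_of_unity {L : ℕ} {η : ℂ} (h1 : η ^ L = 1) :
    ∑ i ∈ Finset.range L, η ^ i = if η = 1 then (L : ℂ) else 0 := by
  split_ifs with h
  · simp [h]
  · have := mul_neg_geom_sum η L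
    rw [h1, sub_self] at this
    exact (mul_eq_zero.1 this).resolve_left (sub_ne_zero.2 (Ne.symm h))

theorem sum_pow_mul_inv_pow {L : ℕ} {ω : ℂ} (hω : IsPrimitiveRoot ω L) {a b : ℕ}
    (ha : a < L) (hb : b < L) :
    ∑ i ∈ Finset.range L, (ω ^ i) ^ a * ((ω ^ i)⁻¹) ^ b = if a = b then (L : ℂ) else 0 := by
  have hω0 : ω ≠ 0 := hω.ne_zero (by omega)
  have h1 : ∀ i, (ω ^ i) ^ a * ((ω ^ i)⁻¹) ^ b = (ω ^ a * (ω ^ b)⁻¹) ^ i := by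
    intro i
    rw [mul_pow, inv_pow, inv_pow, ← pow_mul, ← pow_mul, ← pow_mul, ← pow_mul, mul_comm a,
      mul_comm b]
  simp_rw [h1]
  rw [sum_pow_root_of_unity]
  · have : ω ^ a * (ω ^ b)⁻¹ = 1 ↔ a = b := by
      rw [mul_inv_eq_one₀ (pow_ne_zero _ hω0)]
      exact ⟨fun h => hω.pow_inj ha hb h, fun h => by rw [h]⟩
    simp only [this]
  · rw [mul_pow, inv_pow, ← pow_mul, ← pow_mul, mul_comm a, mul_comm b, pow_mul, pow_mul,
      hω.pow_eq_one]
    simp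

/-- Parseval for a geometric sum over the `L`-th roots of unity. -/
theorem sum_norm_sq_geom {L K : ℕ} (hK : K ≤ L) {ω : ℂ} (hω : IsPrimitiveRoot ω L)
    {z : ℂ} (hz : ‖z‖ = 1) :
    ∑ i ∈ Finset.range L, ‖∑ r ∈ Finset.range K, (z * (ω ^ i)⁻¹) ^ r‖ ^ 2 = L * K := by
  rcases Nat.eq_zero_or_pos L with rfl | hL
  · simp
  have hω0 : ω ≠ 0 := hω.ne_zero (by omega)
  have hωn : ‖ω‖ = 1 := hω.norm'_eq_one (by omega)
  have hz0 : z ≠ 0 := by rintro rfl; simp at hz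
  have hconj : ∀ i, (starRingEnd ℂ) (z * (ω ^ i)⁻¹) = z⁻¹ * ω ^ i := by
    intro i
    have : ‖z * (ω ^ i)⁻¹‖ = 1 := by simp [hz, hωn]
    rw [← Complex.inv_eq_conj this]
    simp [mul_comm]
  apply Complex.ofReal_injective
  push_cast
  have h1 : ∀ i, ((‖∑ r ∈ Finset.range K, (z * (ω ^ i)⁻¹) ^ r‖ : ℂ)) ^ 2 =
      ∑ r ∈ Finset.range K, ∑ s ∈ Finset.range K,
        z⁻¹ ^ r * z ^ s * ((ω ^ i) ^ r * ((ω ^ i)⁻¹) ^ s) := by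
    intro i
    rw [← Complex.conj_mul', map_sum, Finset.sum_mul_sum]
    refine Finset.sum_congr rfl fun r _ => Finset.sum_congr rfl fun s _ => ?_
    rw [map_pow, hconj, mul_pow, mul_pow]; ring
  simp_rw [h1]
  rw [Finset.sum_comm]
  simp_rw [Finset.sum_comm (s := Finset.range L)]
  calc _ = ∑ r ∈ Finset.range K, ∑ s ∈ Finset.range K,
        z⁻¹ ^ r * z ^ s * (if r = s then (L : ℂ) else 0) := by
        refine Finset.sum_congr rfl fun r hr => Finset.sum_congr rfl fun s hs => ?_
        rw [← Finset.mul_sum, sum_pow_mul_inv_pow hω ((Finset.mem_range.1 hr).trans_le hK)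
          ((Finset.mem_range.1 hs).trans_le hK)]
    _ = ∑ r ∈ Finset.range K, (L : ℂ) := by
        refine Finset.sum_congr rfl fun r hr => ?_
        rw [Finset.sum_eq_single_of_mem r hr]
        · rw [if_pos rfl, ← mul_pow, inv_mul_cancel₀ hz0, one_pow, one_mul]
        · intro s _ hs
          rw [if_neg (Ne.symm hs), mul_zero]
    _ = _ := by simp [mul_comm]

/-- The sampling kernel `D_N(w⁻¹) D_{2N}(w)`, with `D_K(w) = 1 + w + ⋯ + w^{K-1}`, reproduces
polynomials of degree less than `N` from their values at the `2N`-th roots of unity. -/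
theorem sum_eval_mul_kernel {N : ℕ} {ω : ℂ} (hω : IsPrimitiveRoot ω (2 * N))
    {z : ℂ} (hz : z ≠ 0) {f : Polynomial ℂ} (hf : f.natDegree < N) :
    ∑ i ∈ Finset.range (2 * N), f.eval (ω ^ i) *
      ((∑ s ∈ Finset.range N, (z⁻¹ * ω ^ i) ^ s) *
        ∑ r ∈ Finset.range (2 * N), (z * (ω ^ i)⁻¹) ^ r) = (2 * N * N : ℂ) * f.eval z := by
  have h1 : ∀ i, f.eval (ω ^ i) * ((∑ s ∈ Finset.range N, (z⁻¹ * ω ^ i) ^ s) *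
        ∑ r ∈ Finset.range (2 * N), (z * (ω ^ i)⁻¹) ^ r) =
      ∑ j ∈ Finset.range N, ∑ s ∈ Finset.range N, ∑ r ∈ Finset.range (2 * N),
        f.coeff j * z⁻¹ ^ s * z ^ r * ((ω ^ i) ^ (j + s) * ((ω ^ i)⁻¹) ^ r) := by
    intro i
    rw [Polynomial.eval_eq_sum_range' hf, Finset.sum_mul_sum, Finset.sum_mul]
    refine Finset.sum_congr rfl fun j _ => ?_
    rw [Finset.mul_sum]
    refine Finset.sum_congr rfl fun s _ => ?_
    rw [Finset.mul_sum]
    refine Finset.sum_congr rfl fun r _ => ?_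
    rw [mul_pow, mul_pow, pow_add]; ring
  simp_rw [h1]
  rw [Finset.sum_comm]
  simp_rw [Finset.sum_comm (s := Finset.range (2 * N)) (t := Finset.range N)]
  rw [Polynomial.eval_eq_sum_range' hf, Finset.mul_sum]
  refine Finset.sum_congr rfl fun j hj => ?_
  have hj := Finset.mem_range.1 hj
  calc _ = ∑ s ∈ Finset.range N, (2 * N : ℂ) * (f.coeff j * z ^ j) := by
        refine Finset.sum_congr rfl fun s hs => ?_
        have hs := Finset.mem_range.1 hs
        rw [Finset.sum_comm, Finset.sum_eq_single_of_mem (j + s) (Finset.mem_range.2 (by omega))]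
        · rw [← Finset.mul_sum, sum_pow_mul_inv_pow hω (by omega) (by omega), if_pos rfl, pow_add]
          have : z⁻¹ ^ s * z ^ s = 1 := by rw [← mul_pow, inv_mul_cancel₀ hz, one_pow]
          push_cast
          linear_combination (f.coeff j * z ^ j * (2 * N)) * this
        · intro r hr hne
          rw [← Finset.mul_sum, sum_pow_mul_inv_pow hω (by omega) (Finset.mem_range.1 hr),
            if_neg (Ne.symm hne), mul_zero]
    _ = _ := by rw [Finset.sum_const, Finset.card_range, nsmul_eq_mul]; ring

theorem norm_eval_le_of_roots_of_unity {N : ℕ} {ω : ℂ} (hω : IsPrimitiveRoot ω (2 * N))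
    {f : Polynomial ℂ} (hf : f.natDegree < N) {Δ : ℝ}
    (hΔ : ∀ i, ‖f.eval (ω ^ i)‖ ≤ Δ) {z : ℂ} (hz : ‖z‖ = 1) :
    ‖f.eval z‖ ≤ 2 * Δ := by
  have hN : 0 < N := by omega
  have hz0 : z ≠ 0 := by rintro rfl; simp at hz
  have hωn : ‖ω‖ = 1 := hω.norm'_eq_one (by omega)
  have hNR : (0 : ℝ) < N := by exact_mod_cast hN
  have hΔ0 : 0 ≤ Δ := (norm_nonneg _).trans (hΔ 0)
  set a : ℕ → ℝ := fun i => ‖∑ s ∈ Finset.range N, (z * (ω ^ i)⁻¹) ^ s‖ with ha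
  set b : ℕ → ℝ := fun i => ‖∑ s ∈ Finset.range (2 * N), (z * (ω ^ i)⁻¹) ^ s‖ with hb
  have hA : ∀ i, ‖∑ s ∈ Finset.range N, (z⁻¹ * ω ^ i) ^ s‖ = a i := by
    intro i
    have h1 : ‖z * (ω ^ i)⁻¹‖ = 1 := by simp [hz, hωn]
    have h2 : z⁻¹ * ω ^ i = (starRingEnd ℂ) (z * (ω ^ i)⁻¹) := by
      rw [← Complex.inv_eq_conj h1]; simp [mul_comm]
    simp_rw [h2, ← map_pow]
    rw [← map_sum, RCLike.norm_conj]
  have hab : ∑ i ∈ Finset.range (2 * N), a i * b i ≤ 2 * N * N * 2 := by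
    have hcs := Finset.sum_mul_sq_le_sq_mul_sq (Finset.range (2 * N)) a b
    rw [ha, hb, sum_norm_sq_geom (by omega) hω hz, sum_norm_sq_geom le_rfl hω hz] at hcs
    refine abs_le_of_sq_le_sq' (hcs.trans ?_) (by positivity) |>.2
    push_cast
    nlinarith [pow_pos hNR 4]
  have hmain := congrArg norm (sum_eval_mul_kernel hω hz0 hf)
  rw [norm_mul] at hmain
  have h2 : ‖(2 * N * N : ℂ)‖ = 2 * N * N := by simp
  rw [h2] at hmain
  have h3 : 2 * N * N * ‖f.eval z‖ ≤ Δ * (2 * N * N * 2) := by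
    rw [← hmain]
    refine (norm_sum_le _ _).trans ?_
    calc _ ≤ ∑ i ∈ Finset.range (2 * N), Δ * (a i * b i) := by
          refine Finset.sum_le_sum fun i _ => ?_
          rw [norm_mul, norm_mul, hA]
          gcongr
          exact hΔ i
      _ ≤ _ := by rw [← Finset.mul_sum]; gcongr
  have h4 : 2 * N * N * ‖f.eval z‖ ≤ 2 * N * N * (2 * Δ) := by linarith
  exact le_of_mul_le_mul_left h4 (by positivity)

/-- A sine polynomial of degree at most `M` is controlled by its values at `4M + 2` points. -/
theorem abs_sum_sin_le_of_grid (M : ℕ) (S : Finset ℕ) (hS : ∀ k ∈ S, k ≤ M) (d : ℕ → ℝ) {Δ : ℝ}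
    (hΔ : ∀ i < 4 * M + 2, |∑ k ∈ S, d k * Real.sin (k * (2 * Real.pi * i / (4 * M + 2)))| ≤ Δ)
    (θ : ℝ) : |∑ k ∈ S, d k * Real.sin (k * θ)| ≤ 2 * Δ := by
  let f : Polynomial ℂ := ∑ k ∈ S, Polynomial.C (d k : ℂ) * (Polynomial.X ^ (M + k) -
    Polynomial.X ^ (M - k))
  have hf : f.natDegree < 2 * M + 1 := by
    refine Nat.lt_succ_of_le (Polynomial.natDegree_sum_le_of_forall_le _ _ fun k hk => ?_)
    have := hS k hk
    refine (Polynomial.natDegree_C_mul_le _ _).trans ((Polynomial.natDegree_sub_le _ _).trans ?_)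
    rw [Polynomial.natDegree_X_pow, Polynomial.natDegree_X_pow]
    omega
  have hev : ∀ t : ℝ, ‖f.eval (Complex.exp (t * Complex.I))‖ =
      2 * |∑ k ∈ S, d k * Real.sin (k * t)| := by
    intro t
    have : f.eval (Complex.exp (t * Complex.I)) =
        Complex.exp (M * (t * Complex.I)) * (2 * Complex.I) *
          ((∑ k ∈ S, d k * Real.sin (k * t) : ℝ) : ℂ) := by
      simp only [f, Polynomial.eval_finsetSum, Polynomial.eval_mul, Polynomial.eval_C,
        Polynomial.eval_sub, Polynomial.eval_pow, Polynomial.eval_X]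
      push_cast
      rw [Finset.mul_sum]
      refine Finset.sum_congr rfl fun k hk => ?_
      rw [Complex.sin, ← Complex.exp_nat_mul, ← Complex.exp_nat_mul, Nat.cast_sub (hS k hk)]
      push_cast
      rw [show (M + k : ℂ) * (t * Complex.I) = M * (t * Complex.I) + k * t * Complex.I by ring,
        show (M - k : ℂ) * (t * Complex.I) = M * (t * Complex.I) + -(k * t) * Complex.I by ring,
        Complex.exp_add, Complex.exp_add]
      have hI := Complex.I_sq
      linear_combination (-(d k * Complex.exp (M * (t * Complex.I)) *
        (Complex.exp (-(k * t) * Complex.I) - Complex.exp (k * t * Complex.I)))) * hI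
    rw [this, norm_mul, norm_mul, Complex.norm_real, Real.norm_eq_abs]
    have h1 : ‖Complex.exp (M * (t * Complex.I))‖ = 1 := by
      rw [show (M : ℂ) * (t * Complex.I) = ((M * t : ℝ) : ℂ) * Complex.I by push_cast; ring]
      exact Complex.norm_exp_ofReal_mul_I _
    rw [h1]; simp
  have hω := Complex.isPrimitiveRoot_exp (2 * (2 * M + 1)) (by omega)
  have hgrid : ∀ i, ‖f.eval (Complex.exp (2 * Real.pi * Complex.I / (2 * (2 * M + 1) : ℕ)) ^ i)‖ ≤
      2 * Δ := by
    intro i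
    rw [← pow_mod_orderOf, ← hω.eq_orderOf]
    set j := i % (2 * (2 * M + 1))
    have hj : j < 4 * M + 2 := by
      have := Nat.mod_lt i (show 2 * (2 * M + 1) > 0 by omega)
      omega
    have : Complex.exp (2 * Real.pi * Complex.I / (2 * (2 * M + 1) : ℕ)) ^ j =
        Complex.exp ((2 * Real.pi * j / (4 * M + 2) : ℝ) * Complex.I) := by
      rw [← Complex.exp_nat_mul]
      congr 1
      push_cast
      rw [show (2 * (2 * M + 1) : ℂ) = 4 * M + 2 by ring]
      ring
    rw [this, hev]
    have := hΔ j hj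
    linarith
  have := norm_eval_le_of_roots_of_unity hω hf hgrid (z := Complex.exp (θ * Complex.I))
    (Complex.norm_exp_ofReal_mul_I θ)
  rw [hev] at this
  linarith

/-! ### Rudin–Shapiro polynomials -/

theorem norm_pow_sub_pow_le_of_norm_eq_one {z w : ℂ} (hz : ‖z‖ = 1) (hw : ‖w‖ = 1) (n : ℕ) :
    ‖z ^ n - w ^ n‖ ≤ n * ‖z - w‖ := by
  induction n with
  | zero => simp
  | succ n ih =>
    have : z ^ (n + 1) - w ^ (n + 1) = z ^ n * (z - w) + (z ^ n - w ^ n) * w := by ring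
    rw [this]
    refine (norm_add_le _ _).trans ?_
    rw [norm_mul, norm_mul, norm_pow, hz, hw, one_pow, one_mul, mul_one]
    push_cast
    linarith

/-- A pair of functions on the unit circle with `|P|² + |Q|² = 2D` that vary slowly, at the rate
that Bernstein's inequality allows for polynomials of degree `D`. -/
structure FlatPair (D : ℝ) (P Q : ℂ → ℂ) : Prop where
  norm_sq_add : ∀ z : ℂ, ‖z‖ = 1 → ‖P z‖ ^ 2 + ‖Q z‖ ^ 2 = 2 * D
  lipschitz_left : ∀ z w : ℂ, ‖z‖ = 1 → ‖w‖ = 1 → ‖P z - P w‖ ≤ 2 * (D * √D) * ‖z - w‖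
  lipschitz_right : ∀ z w : ℂ, ‖z‖ = 1 → ‖w‖ = 1 → ‖Q z - Q w‖ ≤ 2 * (D * √D) * ‖z - w‖

theorem FlatPair.norm_left_le {D : ℝ} {P Q : ℂ → ℂ} (h : FlatPair D P Q) {z : ℂ}
    (hz : ‖z‖ = 1) : ‖P z‖ ≤ √(2 * D) := by
  apply Real.le_sqrt_of_sq_le
  have := h.norm_sq_add z hz
  nlinarith [sq_nonneg ‖Q z‖]

theorem FlatPair.norm_right_le {D : ℝ} {P Q : ℂ → ℂ} (h : FlatPair D P Q) {z : ℂ}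
    (hz : ‖z‖ = 1) : ‖Q z‖ ≤ √(2 * D) := by
  apply Real.le_sqrt_of_sq_le
  have := h.norm_sq_add z hz
  nlinarith [sq_nonneg ‖P z‖]

/-- One step of the Rudin–Shapiro recursion: `P ± z ^ D Q`. -/
theorem FlatPair.step {n : ℕ} {P Q : ℂ → ℂ} (h : FlatPair n P Q) :
    FlatPair ((n + n : ℕ) : ℝ) (fun z => P z + z ^ n * Q z) (fun z => P z - z ^ n * Q z) := by
  set D : ℝ := (n : ℝ) with hD
  have hD0 : 0 ≤ D := by positivity
  have hlip : ∀ z w : ℂ, ‖z‖ = 1 → ‖w‖ = 1 →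
      ‖z ^ n * Q z - w ^ n * Q w‖ ≤ (2 * (D * √D) + D * √(2 * D)) * ‖z - w‖ := by
    intro z w hz hw
    have : z ^ n * Q z - w ^ n * Q w = z ^ n * (Q z - Q w) + (z ^ n - w ^ n) * Q w := by ring
    rw [this]
    refine (norm_add_le _ _).trans ?_
    rw [norm_mul, norm_mul, norm_pow, hz, one_pow, one_mul]
    have h1 := h.lipschitz_right z w hz hw
    have h2 : ‖z ^ n - w ^ n‖ * ‖Q w‖ ≤ D * ‖z - w‖ * √(2 * D) := by
      gcongr
      · exact norm_pow_sub_pow_le_of_norm_eq_one hz hw n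
      · exact h.norm_right_le hw
    linarith
  have hconst : 2 * (D * √D) + (2 * (D * √D) + D * √(2 * D)) ≤
      2 * (((n + n : ℕ) : ℝ) * √((n + n : ℕ) : ℝ)) := by
    have h2 : ((n + n : ℕ) : ℝ) = 2 * D := by push_cast; ring
    rw [h2, Real.sqrt_mul (by norm_num)]
    have h3 : 1.4 ≤ √(2 : ℝ) := Real.le_sqrt_of_sq_le (by norm_num)
    nlinarith [mul_nonneg hD0 (Real.sqrt_nonneg D)]
  refine ⟨fun z hz => ?_, fun z w hz hw => ?_, fun z w hz hw => ?_⟩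
  · have h1 := parallelogram_law_with_norm ℝ (P z) (z ^ n * Q z)
    have h2 := h.norm_sq_add z hz
    rw [norm_mul, norm_pow, hz, one_pow, one_mul] at h1
    push_cast
    nlinarith
  · calc _ = ‖(P z - P w) + (z ^ n * Q z - w ^ n * Q w)‖ := by congr 1; ring
      _ ≤ 2 * (D * √D) * ‖z - w‖ + (2 * (D * √D) + D * √(2 * D)) * ‖z - w‖ :=
          (norm_add_le _ _).trans (add_le_add (h.lipschitz_left z w hz hw) (hlip z w hz hw))
      _ ≤ _ := by rw [← add_mul]; gcongr
  · calc _ = ‖(P z - P w) - (z ^ n * Q z - w ^ n * Q w)‖ := by congr 1; ring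
      _ ≤ 2 * (D * √D) * ‖z - w‖ + (2 * (D * √D) + D * √(2 * D)) * ‖z - w‖ :=
          (norm_sub_le _ _).trans (add_le_add (h.lipschitz_left z w hz hw) (hlip z w hz hw))
      _ ≤ _ := by rw [← add_mul]; gcongr

/-- The polynomial function with real coefficients `p 0, …, p (n - 1)`. -/
noncomputable def polySum (n : ℕ) (p : ℕ → ℝ) (z : ℂ) : ℂ :=
  ∑ j ∈ Finset.range n, (p j : ℂ) * z ^ j

theorem polySum_append (n : ℕ) (p q : ℕ → ℝ) (z : ℂ) :
    polySum (n + n) (fun j => if j < n then p j else q (j - n)) z =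
      polySum n p z + z ^ n * polySum n q z := by
  unfold polySum
  rw [Finset.sum_range_add, Finset.mul_sum]
  congr 1
  · refine Finset.sum_congr rfl fun j hj => ?_
    simp only [if_pos (Finset.mem_range.1 hj)]
  · refine Finset.sum_congr rfl fun j _ => ?_
    simp only [not_lt.2 (Nat.le_add_right n j), if_false, Nat.add_sub_cancel_left, pow_add]; ring

theorem polySum_neg (n : ℕ) (q : ℕ → ℝ) (z : ℂ) :
    polySum n (fun j => -q j) z = -polySum n q z := by
  simp [polySum]

/-- Rudin–Shapiro polynomials. The values at `1` alternate between `(√D, √D)` and `(√(2D), 0)`. -/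
theorem exists_rudinShapiro (t : ℕ) : ∃ p q : ℕ → ℝ, (∀ j, p j = 1 ∨ p j = -1) ∧
    (∀ j, q j = 1 ∨ q j = -1) ∧
    FlatPair ((2 ^ t : ℕ) : ℝ) (polySum (2 ^ t) p) (polySum (2 ^ t) q) ∧
    √((2 ^ t : ℕ) : ℝ) ≤ (polySum (2 ^ t) p 1 + polySum (2 ^ t) q 1).re := by
  suffices H : ∃ p q : ℕ → ℝ, (∀ j, p j = 1 ∨ p j = -1) ∧ (∀ j, q j = 1 ∨ q j = -1) ∧
      FlatPair ((2 ^ t : ℕ) : ℝ) (polySum (2 ^ t) p) (polySum (2 ^ t) q) ∧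
      ((polySum (2 ^ t) p 1 = (√((2 ^ t : ℕ) : ℝ) : ℝ) ∧
          polySum (2 ^ t) q 1 = (√((2 ^ t : ℕ) : ℝ) : ℝ)) ∨
        (polySum (2 ^ t) p 1 = (√(2 * ((2 ^ t : ℕ) : ℝ)) : ℝ) ∧ polySum (2 ^ t) q 1 = 0)) by
    obtain ⟨p, q, hp, hq, hf, h1⟩ := H
    refine ⟨p, q, hp, hq, hf, ?_⟩
    rcases h1 with ⟨h1, h2⟩ | ⟨h1, h2⟩
    · rw [h1, h2, ← Complex.ofReal_add, Complex.ofReal_re]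
      linarith [Real.sqrt_nonneg ((2 ^ t : ℕ) : ℝ)]
    · rw [h1, h2, add_zero, Complex.ofReal_re]
      apply Real.sqrt_le_sqrt
      have : (0 : ℝ) ≤ ((2 ^ t : ℕ) : ℝ) := by positivity
      linarith
  induction t with
  | zero =>
    refine ⟨fun _ => 1, fun _ => 1, fun _ => Or.inl rfl, fun _ => Or.inl rfl, ⟨?_, ?_, ?_⟩, ?_⟩
    · intro z _; norm_num [polySum]
    · intro z w _ _; simp [polySum]
    · intro z w _ _; simp [polySum]
    · left; simp [polySum]
  | succ t ih =>
    obtain ⟨p, q, hp, hq, hf, h1⟩ := ih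
    refine ⟨fun j => if j < 2 ^ t then p j else q (j - 2 ^ t),
      fun j => if j < 2 ^ t then p j else -q (j - 2 ^ t), fun j => ?_, fun j => ?_, ?_, ?_⟩
    · dsimp only; split_ifs
      exacts [hp j, hq _]
    · dsimp only; split_ifs
      · exact hp j
      · rcases hq (j - 2 ^ t) with h | h <;> simp [h]
    · have := hf.step
      rw [show 2 ^ (t + 1) = 2 ^ t + 2 ^ t by ring]
      convert this using 1
      · funext z; exact polySum_append _ _ _ _
      · funext z
        rw [polySum_append (2 ^ t) p (fun j => -q j), polySum_neg]; ring
    · rw [show 2 ^ (t + 1) = 2 ^ t + 2 ^ t by ring, polySum_append,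
        polySum_append (2 ^ t) p (fun j => -q j), polySum_neg, one_pow, one_mul, one_mul]
      have hdouble : ((2 ^ t + 2 ^ t : ℕ) : ℝ) = 2 * ((2 ^ t : ℕ) : ℝ) := by push_cast; ring
      rw [hdouble]
      rcases h1 with ⟨h1, h2⟩ | ⟨h1, h2⟩
      · right
        rw [h1, h2, ← mul_assoc, Real.sqrt_mul (by norm_num), show (2 * 2 : ℝ) = 2 ^ 2 by norm_num,
          Real.sqrt_sq (by norm_num)]
        push_cast
        constructor <;> ring
      · left
        rw [h1, h2]
        constructor <;> ring

/-! ### Small values of the cosine part are sparse -/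

theorem norm_le_of_abs_re_le {p q : ℂ} {B : ℝ}
    (h : ∀ w : ℂ, ‖w‖ = 1 → |(p * w + q * w ^ 2).re| ≤ B) : ‖p‖ ≤ B ∧ ‖q‖ ≤ B := by
  have harg : ∀ r : ℂ, r * Complex.exp (((-r.arg : ℝ) : ℂ) * Complex.I) = ‖r‖ := by
    intro r
    nth_rewrite 1 [← Complex.norm_mul_exp_arg_mul_I r]
    rw [mul_assoc, ← Complex.exp_add, ← add_mul, ← Complex.ofReal_add, add_neg_cancel]
    simp
  -- Comparing `w` with `-w` separates the odd term from the even one.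
  have hsep : ∀ w : ℂ, ‖w‖ = 1 → |(p * w).re| ≤ B ∧ |(q * w ^ 2).re| ≤ B := by
    intro w hw
    have h1 := h w hw
    have h2 := h (-w) (by rwa [norm_neg])
    rw [neg_sq, mul_neg, Complex.add_re, Complex.neg_re] at h2
    rw [Complex.add_re] at h1
    rw [abs_le] at *
    rw [abs_le]
    refine ⟨⟨?_, ?_⟩, ?_, ?_⟩ <;> linarith
  constructor
  · have h1 := (hsep _ (Complex.norm_exp_ofReal_mul_I (-p.arg))).1
    rwa [harg, Complex.ofReal_re, abs_norm] at h1
  · have h1 := (hsep _ (Complex.norm_exp_ofReal_mul_I (-q.arg / 2))).2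
    rw [← Complex.exp_nat_mul] at h1
    have h2 : ((2 : ℕ) : ℂ) * (((-q.arg / 2 : ℝ) : ℂ) * Complex.I) =
        ((-q.arg : ℝ) : ℂ) * Complex.I := by push_cast; ring
    rwa [h2, harg, Complex.ofReal_re, abs_norm] at h1

/-- Lagrange interpolation bounds a polynomial on the circle by its values at separated nodes. -/
theorem norm_eval_le_of_separated {ι : Type*} [DecidableEq ι] (s : Finset ι) (v : ι → ℂ)
    (hv : ∀ i ∈ s, ‖v i‖ = 1) {h : ℝ} (hh : 0 < h)
    (hsep : ∀ i ∈ s, ∀ j ∈ s, i ≠ j → h ≤ ‖v i - v j‖) {f : Polynomial ℂ}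
    (hf : f.degree < s.card) {E : ℝ} (hE : ∀ i ∈ s, ‖f.eval (v i)‖ ≤ E) {z : ℂ} (hz : ‖z‖ = 1) :
    ‖f.eval z‖ ≤ s.card * (E * (2 / h) ^ (s.card - 1)) := by
  have hinj : Set.InjOn v s := by
    intro i hi j hj hij
    by_contra hne
    have := hsep i hi j hj hne
    rw [hij, sub_self, norm_zero] at this
    linarith
  rw [Lagrange.eq_interpolate hinj hf, Lagrange.interpolate_apply, Polynomial.eval_finsetSum]
  refine (norm_sum_le _ _).trans ?_
  have hcard : (s.card : ℝ) * (E * (2 / h) ^ (s.card - 1)) =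
      ∑ _i ∈ s, E * (2 / h) ^ (s.card - 1) := by rw [Finset.sum_const, nsmul_eq_mul]
  rw [hcard]
  refine Finset.sum_le_sum fun i hi => ?_
  rw [Polynomial.eval_mul, Polynomial.eval_C, norm_mul]
  have hE0 : 0 ≤ E := (norm_nonneg _).trans (hE i hi)
  gcongr
  · exact hE i hi
  · rw [Lagrange.basis, Polynomial.eval_prod, norm_prod, ← Finset.card_erase_of_mem hi]
    rw [← Finset.prod_const]
    refine Finset.prod_le_prod (fun _ _ => norm_nonneg _) fun j hj => ?_
    have hj' := Finset.mem_erase.1 hj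
    rw [Lagrange.basisDivisor, Polynomial.eval_mul, Polynomial.eval_C, norm_mul, norm_inv]
    have h1 : ‖(Polynomial.X - Polynomial.C (v j)).eval z‖ ≤ 2 := by
      simp only [Polynomial.eval_sub, Polynomial.eval_X, Polynomial.eval_C]
      refine (norm_sub_le _ _).trans ?_
      rw [hz, hv j hj'.2]; norm_num
    have h2 := hsep i hi j hj'.2 (Ne.symm hj'.1)
    rw [div_eq_inv_mul]
    gcongr

theorem norm_exp_sub_exp (x y : ℝ) :
    ‖Complex.exp (x * Complex.I) - Complex.exp (y * Complex.I)‖ = 2 * |Real.sin ((x - y) / 2)| := by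
  have : Complex.exp (x * Complex.I) - Complex.exp (y * Complex.I) =
      Complex.exp (y * Complex.I) * (Complex.exp (Complex.I * ((x - y : ℝ) : ℂ)) - 1) := by
    rw [mul_sub, ← Complex.exp_add, mul_one]
    push_cast
    ring_nf
  rw [this, norm_mul, Complex.norm_exp_ofReal_mul_I, one_mul,
    Complex.norm_exp_I_mul_ofReal_sub_one, Real.norm_eq_abs, abs_mul, abs_two]

theorem norm_exp_sub_exp_le (x y : ℝ) :
    ‖Complex.exp (x * Complex.I) - Complex.exp (y * Complex.I)‖ ≤ |x - y| := by
  rw [norm_exp_sub_exp]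
  have h1 : |Real.sin ((x - y) / 2)| ≤ |(x - y) / 2| := Real.abs_sin_le_abs
  rw [abs_div, abs_two] at h1
  linarith

theorem le_norm_exp_sub_exp {x y : ℝ} (h : |x - y| ≤ Real.pi) :
    |x - y| / 2 ≤ ‖Complex.exp (x * Complex.I) - Complex.exp (y * Complex.I)‖ := by
  rw [norm_exp_sub_exp]
  have h1 := Real.mul_abs_le_abs_sin (x := (x - y) / 2) (by
    rw [abs_div, abs_two]; linarith)
  rw [abs_div, abs_two] at h1
  have h2 : (1 / 2 : ℝ) ≤ 2 / Real.pi := by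
    rw [div_le_div_iff₀ (by norm_num) Real.pi_pos]; linarith [Real.pi_le_four]
  nlinarith [abs_nonneg (x - y)]

/-- The function `θ ↦ Re (z ^ a P(z) + z ^ (2a) Q(z))`, where `z = exp (2iθ)`. -/
noncomputable def cosPart (P Q : ℂ → ℂ) (a : ℕ) (θ : ℝ) : ℝ :=
  (Complex.exp ((2 * θ : ℝ) * Complex.I) ^ a * P (Complex.exp ((2 * θ : ℝ) * Complex.I)) +
    Complex.exp ((2 * θ : ℝ) * Complex.I) ^ (2 * a) *
      Q (Complex.exp ((2 * θ : ℝ) * Complex.I))).re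

/-- Over a window of length `1 / (2a)` with `a` much larger than `D`, the functions `P` and `Q` are
nearly constant, so that the cosine part is nearly `Re (p w + q w²)` for `w = exp (2iaθ)`. Up to
the unit factor `2w²` this is a polynomial of degree four in `w`; if it were small at five
separated points, then `p` and `q` would both be small. -/
theorem not_five_separated_small {D : ℝ} (hD : 0 < D) {P Q : ℂ → ℂ} (hPQ : FlatPair D P Q)
    {a : ℕ} {A h ε : ℝ} (hA : 0 < A) (ha : a = A * D) (hh : 0 < h)
    (hsmall : 80 * (ε + 4 / A) < h ^ 4) {s : Finset ℕ} (hs : s.card = 5) (θ : ℕ → ℝ)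
    (hwin : ∀ i ∈ s, ∀ j ∈ s, |θ i - θ j| ≤ 1 / (2 * a))
    (hsep : ∀ i ∈ s, ∀ j ∈ s, i ≠ j → h ≤ a * |θ i - θ j|)
    (hu : ∀ i ∈ s, |cosPart P Q a (θ i)| ≤ ε * √D) : False := by
  have ha0 : (0 : ℝ) < a := by rw [ha]; positivity
  obtain ⟨i₀, hi₀⟩ : s.Nonempty := Finset.card_pos.1 (by omega)
  set Z : ℕ → ℂ := fun i => Complex.exp ((2 * θ i : ℝ) * Complex.I) with hZ
  have hZn : ∀ i, ‖Z i‖ = 1 := fun i => Complex.norm_exp_ofReal_mul_I _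
  set p := P (Z i₀) with hp
  set q := Q (Z i₀) with hq
  set v : ℕ → ℂ := fun i => Z i ^ a with hv
  have hvn : ∀ i, ‖v i‖ = 1 := fun i => by rw [hv]; simp [hZn]
  have hvexp : ∀ i, v i = Complex.exp ((2 * a * θ i : ℝ) * Complex.I) := fun i => by
    simp only [hv, hZ]
    rw [← Complex.exp_nat_mul]; push_cast; ring_nf
  have hvsep : ∀ i ∈ s, ∀ j ∈ s, i ≠ j → h ≤ ‖v i - v j‖ := by
    intro i hi j hj hij
    rw [hvexp, hvexp]
    have e : |2 * a * θ i - 2 * a * θ j| = 2 * a * |θ i - θ j| := by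
      rw [← mul_sub, abs_mul, abs_of_pos (by positivity)]
    have h1 : 2 * a * |θ i - θ j| ≤ Real.pi := by
      calc 2 * a * |θ i - θ j| ≤ 2 * a * (1 / (2 * a)) := by gcongr; exact hwin i hi j hj
        _ = 1 := by field_simp
        _ ≤ Real.pi := by linarith [Real.pi_gt_three]
    have h2 := le_norm_exp_sub_exp (x := 2 * a * θ i) (y := 2 * a * θ j) (by rwa [e])
    rw [e] at h2
    have h3 := hsep i hi j hj hij
    linarith
  let f : Polynomial ℂ := Polynomial.C q * Polynomial.X ^ 4 + Polynomial.C p * Polynomial.X ^ 3 +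
    Polynomial.C (starRingEnd ℂ p) * Polynomial.X + Polynomial.C (starRingEnd ℂ q)
  have hfd : f.degree < s.card := by
    rw [hs]
    refine lt_of_le_of_lt (b := ((4 : ℕ) : WithBot ℕ)) ?_ (by norm_num)
    simp only [f]
    compute_degree
    exact le_rfl
  have hfe : ∀ w : ℂ, ‖w‖ = 1 → ‖f.eval w‖ = 2 * |(p * w + q * w ^ 2).re| := by
    intro w hw
    have hw0 : w * starRingEnd ℂ w = 1 := by rw [Complex.mul_conj']; simp [hw]
    have : f.eval w = w ^ 2 * ((2 * (p * w + q * w ^ 2).re : ℝ) : ℂ) := by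
      rw [← Complex.add_conj]
      simp only [f, Polynomial.eval_add, Polynomial.eval_mul, Polynomial.eval_C,
        Polynomial.eval_pow, Polynomial.eval_X, map_add, map_mul, map_pow]
      linear_combination (-(starRingEnd ℂ p * w) -
        starRingEnd ℂ q * (w * starRingEnd ℂ w + 1)) * hw0
    rw [this, norm_mul, norm_pow, hw, one_pow, one_mul, Complex.norm_real, Real.norm_eq_abs,
      abs_mul, abs_two]
  have hE : ∀ i ∈ s, ‖f.eval (v i)‖ ≤ 2 * ((ε + 4 / A) * √D) := by
    intro i hi
    rw [hfe _ (hvn i)]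
    have hdist : ‖Z i - Z i₀‖ ≤ 1 / a := by
      refine (norm_exp_sub_exp_le _ _).trans ?_
      rw [← mul_sub, abs_mul, abs_two]
      calc 2 * |θ i - θ i₀| ≤ 2 * (1 / (2 * a)) := by gcongr; exact hwin i hi i₀ hi₀
        _ = 1 / a := by field_simp
    have hc : 2 * (D * √D) * (1 / a) = 2 / A * √D := by rw [ha]; field_simp
    have hP : ‖P (Z i) - p‖ ≤ 2 / A * √D := by
      rw [← hc]
      refine (hPQ.lipschitz_left _ _ (hZn i) (hZn i₀)).trans ?_
      gcongr
    have hQ : ‖Q (Z i) - q‖ ≤ 2 / A * √D := by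
      rw [← hc]
      refine (hPQ.lipschitz_right _ _ (hZn i) (hZn i₀)).trans ?_
      gcongr
    have heq : (p * v i + q * v i ^ 2).re =
        cosPart P Q a (θ i) - (v i * (P (Z i) - p) + v i ^ 2 * (Q (Z i) - q)).re := by
      have : cosPart P Q a (θ i) = (v i * P (Z i) + v i ^ 2 * Q (Z i)).re := by
        simp only [cosPart, hv, hZ]
        rw [← pow_mul, mul_comm a 2]
      rw [this, ← Complex.sub_re]
      congr 1; ring
    have herr : |(v i * (P (Z i) - p) + v i ^ 2 * (Q (Z i) - q)).re| ≤ 4 / A * √D := by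
      refine (Complex.abs_re_le_norm _).trans ((norm_add_le _ _).trans ?_)
      rw [norm_mul, norm_mul, hvn, norm_pow, hvn, one_pow, one_mul, one_mul]
      calc _ ≤ 2 / A * √D + 2 / A * √D := add_le_add hP hQ
        _ = _ := by ring
    rw [heq]
    have := abs_sub (cosPart P Q a (θ i)) (v i * (P (Z i) - p) + v i ^ 2 * (Q (Z i) - q)).re
    have := hu i hi
    linarith
  have hD' : 0 < √D := Real.sqrt_pos.2 hD
  have hB : ∀ w : ℂ, ‖w‖ = 1 → |(p * w + q * w ^ 2).re| ≤
      80 * ((ε + 4 / A) / h ^ 4) * √D := by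
    intro w hw
    have h1 := norm_eval_le_of_separated s v (fun i _ => hvn i) hh hvsep hfd hE hw
    rw [hfe w hw, hs, div_pow] at h1
    have : ((5 : ℕ) : ℝ) * (2 * ((ε + 4 / A) * √D) * (2 ^ (5 - 1) / h ^ (5 - 1))) =
        2 * (80 * ((ε + 4 / A) / h ^ 4) * √D) := by
      norm_num; ring
    linarith
  obtain ⟨hp1, hq1⟩ := norm_le_of_abs_re_le hB
  have hlt : 80 * ((ε + 4 / A) / h ^ 4) * √D < √D := by
    have : 80 * ((ε + 4 / A) / h ^ 4) < 1 := by
      rw [← mul_div_assoc, div_lt_one (by positivity)]; exact hsmall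
    nlinarith
  have h2 := hPQ.norm_sq_add (Z i₀) (hZn i₀)
  rw [← hp, ← hq] at h2
  have h3 := Real.sq_sqrt hD.le
  nlinarith [norm_nonneg p, norm_nonneg q]

theorem half_sqrt_le_abs_cosPart {D : ℝ} (hD : 0 < D) {P Q : ℂ → ℂ} (hPQ : FlatPair D P Q)
    (h1 : √D ≤ (P 1 + Q 1).re) {a : ℕ} (ha : D ≤ a) {θ : ℝ} (hθ0 : 0 ≤ θ) (hθ : 34 * (a * θ) ≤ 1) :
    √D / 2 ≤ |cosPart P Q a θ| := by
  set z := Complex.exp ((2 * θ : ℝ) * Complex.I) with hz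
  have hzn : ‖z‖ = 1 := Complex.norm_exp_ofReal_mul_I _
  have hz1 : ‖z - 1‖ ≤ 2 * θ := by
    have := norm_exp_sub_exp_le (2 * θ) 0
    rw [Complex.ofReal_zero, zero_mul, Complex.exp_zero, sub_zero, abs_of_nonneg (by linarith)]
      at this
    exact this
  have hpow : ∀ n : ℕ, ‖z ^ n - 1‖ ≤ n * (2 * θ) := by
    intro n
    have := norm_pow_sub_pow_le_of_norm_eq_one hzn norm_one n
    rw [one_pow] at this
    exact this.trans (by gcongr)
  have h2D : √(2 * D) ≤ 3 / 2 * √D := by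
    rw [Real.sqrt_mul (by norm_num)]
    gcongr
    rw [Real.sqrt_le_left (by norm_num)]; norm_num
  have key : ∀ (n : ℕ) (F : ℂ → ℂ), ‖F z - F 1‖ ≤ 2 * (D * √D) * ‖z - 1‖ → ‖F 1‖ ≤ √(2 * D) →
      ‖z ^ n * F z - F 1‖ ≤ (4 * D + 3 * n) * θ * √D := by
    intro n F hF hF1
    have : z ^ n * F z - F 1 = z ^ n * (F z - F 1) + (z ^ n - 1) * F 1 := by ring
    rw [this]
    refine (norm_add_le _ _).trans ?_
    rw [norm_mul, norm_mul, norm_pow, hzn, one_pow, one_mul]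
    calc _ ≤ 2 * (D * √D) * (2 * θ) + n * (2 * θ) * (3 / 2 * √D) := by
          gcongr
          · exact hF.trans (by gcongr)
          · exact hpow n
          · exact hF1.trans h2D
      _ = _ := by ring
  have k1 := key a P (hPQ.lipschitz_left z 1 hzn norm_one) (hPQ.norm_left_le norm_one)
  have k2 := key (2 * a) Q (hPQ.lipschitz_right z 1 hzn norm_one) (hPQ.norm_right_le norm_one)
  have hre : |cosPart P Q a θ - (P 1 + Q 1).re| ≤ 17 * (a * θ) * √D := by
    have : cosPart P Q a θ - (P 1 + Q 1).re =
        ((z ^ a * P z - P 1) + (z ^ (2 * a) * Q z - Q 1)).re := by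
      rw [cosPart, ← hz, ← Complex.sub_re]; congr 1; ring
    rw [this]
    refine (Complex.abs_re_le_norm _).trans ((norm_add_le _ _).trans ((add_le_add k1 k2).trans ?_))
    rw [← add_mul, ← add_mul]
    gcongr ?_ * √D
    push_cast
    nlinarith
  have h3 : 17 * (a * θ) * √D ≤ 1 / 2 * √D := by gcongr; linarith
  have h4 := (abs_le.1 hre).1
  refine le_trans ?_ (le_abs_self _)
  linarith

theorem abs_cosPart_le {D : ℝ} {P Q : ℂ → ℂ} (hPQ : FlatPair D P Q) (a : ℕ) (θ : ℝ) :
    |cosPart P Q a θ| ≤ 2 * √(2 * D) := by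
  have hzn := Complex.norm_exp_ofReal_mul_I (2 * θ)
  refine (Complex.abs_re_le_norm _).trans ((norm_add_le _ _).trans ?_)
  rw [norm_mul, norm_mul, norm_pow, norm_pow, hzn, one_pow, one_pow, one_mul, one_mul]
  linarith [hPQ.norm_left_le hzn, hPQ.norm_right_le hzn]

theorem cosPart_polySum (n : ℕ) (p q : ℕ → ℝ) (a : ℕ) (θ : ℝ) :
    cosPart (polySum n p) (polySum n q) a θ =
      ∑ j ∈ Finset.range n, p j * Real.cos ((2 * (a + j) : ℕ) * θ) +
        ∑ j ∈ Finset.range n, q j * Real.cos ((2 * (2 * a + j) : ℕ) * θ) := by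
  have key : ∀ (b : ℕ) (r : ℕ → ℝ), (Complex.exp ((2 * θ : ℝ) * Complex.I) ^ b *
      polySum n r (Complex.exp ((2 * θ : ℝ) * Complex.I))).re =
      ∑ j ∈ Finset.range n, r j * Real.cos ((2 * (b + j) : ℕ) * θ) := by
    intro b r
    rw [polySum, Finset.mul_sum, Complex.re_sum]
    refine Finset.sum_congr rfl fun j _ => ?_
    have : Complex.exp ((2 * θ : ℝ) * Complex.I) ^ b *
        ((r j : ℂ) * Complex.exp ((2 * θ : ℝ) * Complex.I) ^ j) =
        (r j : ℂ) * Complex.exp (((2 * (b + j) : ℕ) * θ : ℝ) * Complex.I) := by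
      rw [mul_left_comm, ← pow_add, ← Complex.exp_nat_mul]
      push_cast
      ring_nf
    rw [this, Complex.re_ofReal_mul, Complex.exp_ofReal_mul_I_re]
  rw [cosPart, Complex.add_re, key, key]

theorem cosPart_polySum_neg (n : ℕ) (p q : ℕ → ℝ) (a : ℕ) (θ : ℝ) :
    cosPart (polySum n p) (polySum n q) a (-θ) = cosPart (polySum n p) (polySum n q) a θ := by
  simp only [cosPart_polySum, mul_neg, Real.cos_neg]

theorem cosPart_add_int_mul_pi (P Q : ℂ → ℂ) (a : ℕ) (θ : ℝ) (m : ℤ) :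
    cosPart P Q a (θ + m * Real.pi) = cosPart P Q a θ := by
  have : Complex.exp ((2 * (θ + m * Real.pi) : ℝ) * Complex.I) =
      Complex.exp ((2 * θ : ℝ) * Complex.I) := by
    rw [Complex.exp_eq_exp_iff_exists_int]
    exact ⟨m, by push_cast; ring⟩
  rw [cosPart, this, cosPart]

/-! ### Blocks of cells -/

/-- Suppose that no window of `W` consecutive integers contains five bad ones that are pairwise
non-adjacent. Then every window contains a separator, at distance more than `R` from all bad
integers, and the separators cut the bad integers into blocks of bounded size that are more than
`R` apart. -/
theorem exists_blocks {R W : ℕ} (hW : 10 * R + 9 ≤ W) (bad : ℕ → Prop)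
    (H : ∀ i, ∀ s : Finset ℕ, (∀ j ∈ s, bad j ∧ i * W ≤ j ∧ j < (i + 1) * W) →
      (∀ j ∈ s, ∀ k ∈ s, j < k → j + 2 ≤ k) → s.card ≠ 5) :
    ∃ blk : ℕ → ℕ, (∀ j, blk j ≤ j / W + 1) ∧
      (∀ j k, bad j → bad k → blk j ≠ blk k → j + R < k ∨ k + R < j) ∧
      ∀ v, ∀ s : Finset ℕ, (∀ j ∈ s, bad j ∧ blk j = v) → s.card ≤ 16 := by
  classical
  have hW0 : 0 < W := by omega
  have hdiv : ∀ j, j / W * W ≤ j ∧ j < (j / W + 1) * W := fun j =>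
    ⟨Nat.div_mul_le_self j W, by
      have := Nat.lt_mul_div_succ j hW0
      rwa [mul_comm] at this⟩
  have hwin8 : ∀ i, ∀ s : Finset ℕ, (∀ j ∈ s, bad j ∧ i * W ≤ j ∧ j < (i + 1) * W) →
      s.card ≤ 8 := by
    intro i s hs
    by_contra hcard
    have hpar := Finset.card_filter_add_card_filter_not (s := s) (fun j => j % 2 = 0)
    have key : ∀ t ⊆ s, (∀ j ∈ t, ∀ k ∈ t, j % 2 = k % 2) → t.card < 5 := by
      intro t ht hpt
      by_contra h5
      obtain ⟨r, hr, hr5⟩ := Finset.exists_subset_card_eq (not_lt.1 h5)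
      refine H i r (fun j hj => hs j (ht (hr hj))) (fun j hj k hk hjk => ?_) hr5
      have := hpt j (hr hj) k (hr hk)
      omega
    have h1 := key _ (Finset.filter_subset (fun j => j % 2 = 0) s) fun j hj k hk => by
      rw [(Finset.mem_filter.1 hj).2, (Finset.mem_filter.1 hk).2]
    have h2 := key _ (Finset.filter_subset (fun j => ¬ j % 2 = 0) s) fun j hj k hk => by
      have := (Finset.mem_filter.1 hj).2
      have := (Finset.mem_filter.1 hk).2
      omega
    omega
  -- Of five candidates `2R + 2` apart one is a separator, since bad integers within `R` of different
  -- candidates are not adjacent.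
  have hgap : ∀ i, ∃ g, i * W ≤ g ∧ g < (i + 1) * W ∧ ∀ j, bad j → j + R < g ∨ g + R < j := by
    intro i
    by_contra hcon
    push Not at hcon
    have hWi : (i + 1) * W = i * W + W := by ring
    have hch : ∀ l : ℕ, ∃ j, l < 5 → bad j ∧ i * W + R + (2 * R + 2) * l ≤ j + R ∧
        j ≤ i * W + R + (2 * R + 2) * l + R := by
      intro l
      by_cases hl : l < 5
      · have hle : (2 * R + 2) * l ≤ (2 * R + 2) * 4 := Nat.mul_le_mul_left _ (by omega)
        obtain ⟨j, hj, h1, h2⟩ := hcon (i * W + R + (2 * R + 2) * l) (by omega) (by omega)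
        exact ⟨j, fun _ => ⟨hj, h1, h2⟩⟩
      · exact ⟨0, fun h => absurd h hl⟩
    choose f hf using hch
    have hstep : ∀ l < 5, ∀ l' < 5, l < l' → f l + 2 ≤ f l' := by
      intro l hl l' hl' hll
      obtain ⟨_, _, h1⟩ := hf l hl
      obtain ⟨_, h2, _⟩ := hf l' hl'
      have : (2 * R + 2) * (l + 1) ≤ (2 * R + 2) * l' := Nat.mul_le_mul_left _ hll
      rw [mul_add, mul_one] at this
      omega
    refine H i ((Finset.range 5).image f) ?_ ?_ ?_
    · intro j hj
      obtain ⟨l, hl, rfl⟩ := Finset.mem_image.1 hj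
      have hl := Finset.mem_range.1 hl
      obtain ⟨h0, h1, h2⟩ := hf l hl
      have hle : (2 * R + 2) * l ≤ (2 * R + 2) * 4 := Nat.mul_le_mul_left _ (by omega)
      exact ⟨h0, by omega, by omega⟩
    · intro j hj k hk hjk
      obtain ⟨l, hl, rfl⟩ := Finset.mem_image.1 hj
      obtain ⟨l', hl', rfl⟩ := Finset.mem_image.1 hk
      have hl := Finset.mem_range.1 hl
      have hl' := Finset.mem_range.1 hl'
      rcases lt_trichotomy l l' with h | h | h
      · exact hstep l hl l' hl' h
      · rw [h] at hjk; omega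
      · have := hstep l' hl' l hl h; omega
    · rw [Finset.card_image_of_injOn, Finset.card_range]
      intro l hl l' hl' hll
      have hl := Finset.mem_range.1 hl
      have hl' := Finset.mem_range.1 hl'
      rcases lt_trichotomy l l' with h | h | h
      · have := hstep l hl l' hl' h
        omega
      · exact h
      · have := hstep l' hl' l hl h
        omega
  choose g hg1 hg2 hg3 using hgap
  let blk : ℕ → ℕ := fun j => if j < g (j / W) then j / W else j / W + 1
  have hblk : ∀ j, (j < g (j / W) ∧ blk j = j / W) ∨ (g (j / W) ≤ j ∧ blk j = j / W + 1) := by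
    intro j
    by_cases h : j < g (j / W)
    · exact Or.inl ⟨h, if_pos h⟩
    · exact Or.inr ⟨not_lt.1 h, if_neg h⟩
  -- A separator lies between any two cells of different blocks.
  have hsepar : ∀ j k, j ≤ k → blk j ≠ blk k → ∃ i, j < g i ∧ g i ≤ k := by
    intro j k hjk hne
    have hmono : j / W ≤ k / W := Nat.div_le_div_right hjk
    rcases hblk j with ⟨h1, h2⟩ | ⟨h1, h2⟩
    · refine ⟨j / W, h1, ?_⟩
      rcases hmono.lt_or_eq with h | h
      · have e1 := hg2 (j / W)
        have e2 : (j / W + 1) * W ≤ k / W * W := Nat.mul_le_mul_right _ h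
        have e3 := (hdiv k).1
        omega
      · rcases hblk k with ⟨h3, h4⟩ | ⟨h3, h4⟩
        · omega
        · rw [h]; exact h3
    · have hlt : j / W < k / W := by
        rcases hmono.lt_or_eq with h | h
        · exact h
        · rcases hblk k with ⟨h3, h4⟩ | ⟨h3, h4⟩
          · rw [← h] at h3; omega
          · omega
      refine ⟨j / W + 1, ?_, ?_⟩
      · have e1 := hg1 (j / W + 1)
        have e2 := (hdiv j).2
        omega
      · rcases Nat.lt_or_ge (j / W + 1) (k / W) with h | h
        · have e1 := hg2 (j / W + 1)
          have e2 : (j / W + 1 + 1) * W ≤ k / W * W := Nat.mul_le_mul_right _ h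
          have e3 := (hdiv k).1
          omega
        · have e : k / W = j / W + 1 := by omega
          rcases hblk k with ⟨h3, h4⟩ | ⟨h3, h4⟩
          · omega
          · rw [← e]; exact h3
  refine ⟨blk, fun j => ?_, fun j k hj hk hne => ?_, fun v s hs => ?_⟩
  · rcases hblk j with h | h <;> omega
  · rcases le_total j k with h | h
    · obtain ⟨i, h1, h2⟩ := hsepar j k h hne
      have := hg3 i j hj
      have := hg3 i k hk
      omega
    · obtain ⟨i, h1, h2⟩ := hsepar k j h (Ne.symm hne)
      have := hg3 i j hj
      have := hg3 i k hk
      omega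
  · have hpar := Finset.card_filter_add_card_filter_not (s := s) (fun j => j / W = v)
    have h1 := hwin8 v (s.filter fun j => j / W = v) fun j hj => by
      obtain ⟨h1, h2⟩ := Finset.mem_filter.1 hj
      have := hdiv j
      rw [h2] at this
      exact ⟨(hs j h1).1, this⟩
    have h2 := hwin8 (v - 1) (s.filter fun j => ¬ j / W = v) fun j hj => by
      obtain ⟨h1, h2⟩ := Finset.mem_filter.1 hj
      have h3 := (hs j h1).2
      have h4 : j / W = v - 1 := by
        rcases hblk j with ⟨_, h⟩ | ⟨_, h⟩
        · exact absurd (h.symm.trans h3) h2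
        · exact Nat.eq_sub_of_add_eq (h.symm.trans h3)
      have := hdiv j
      rw [h4] at this
      exact ⟨(hs j h1).1, this⟩
    omega

/-! ### A localized kernel with odd frequencies -/

/-- A Fejér kernel in `2x`, modulated by `cos x`: its frequencies are odd and less than `2L` in
absolute value, and it has height `1` and width `1 / L`. -/
noncomputable def oddKernel (L : ℕ) (x : ℝ) : ℝ :=
  (∑ i ∈ Finset.range L, ∑ j ∈ Finset.range L,
    Real.cos (((2 * ((i : ℤ) - j) + 1 : ℤ) : ℝ) * x)) / (L : ℝ) ^ 2

theorem oddKernel_eq (L : ℕ) (x : ℝ) : oddKernel L x = Real.cos x *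
    ‖∑ j ∈ Finset.range L, Complex.exp ((2 * x : ℝ) * Complex.I) ^ j‖ ^ 2 / (L : ℝ) ^ 2 := by
  rw [oddKernel]
  congr 1
  have hre : ∑ j ∈ Finset.range L, Complex.exp ((2 * x : ℝ) * Complex.I) ^ j =
      (⟨∑ j ∈ Finset.range L, Real.cos (2 * j * x), ∑ j ∈ Finset.range L, Real.sin (2 * j * x)⟩ :
        ℂ) := by
    have h : ∀ j : ℕ, Complex.exp ((2 * x : ℝ) * Complex.I) ^ j =
        Complex.exp ((2 * j * x : ℝ) * Complex.I) := by
      intro j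
      rw [← Complex.exp_nat_mul]; push_cast; ring_nf
    apply Complex.ext
    · rw [Complex.re_sum]
      exact Finset.sum_congr rfl fun j _ => by rw [h, Complex.exp_ofReal_mul_I_re]
    · rw [Complex.im_sum]
      exact Finset.sum_congr rfl fun j _ => by rw [h, Complex.exp_ofReal_mul_I_im]
  rw [hre, Complex.sq_norm, Complex.normSq_mk, Finset.sum_mul_sum, Finset.sum_mul_sum]
  have hc : ∀ i j : ℕ, Real.cos (((2 * ((i : ℤ) - j) + 1 : ℤ) : ℝ) * x) =
      Real.cos x * (Real.cos (2 * i * x) * Real.cos (2 * j * x) +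
        Real.sin (2 * i * x) * Real.sin (2 * j * x)) -
      Real.sin x * (Real.sin (2 * i * x) * Real.cos (2 * j * x) -
        Real.cos (2 * i * x) * Real.sin (2 * j * x)) := by
    intro i j
    rw [← Real.cos_sub, ← Real.sin_sub, mul_comm (Real.cos x), mul_comm (Real.sin x),
      ← Real.cos_add]
    push_cast
    ring_nf
  have hanti : ∑ i ∈ Finset.range L, ∑ j ∈ Finset.range L,
        Real.sin x * (Real.sin (2 * i * x) * Real.cos (2 * j * x)) =
      ∑ i ∈ Finset.range L, ∑ j ∈ Finset.range L,
        Real.sin x * (Real.cos (2 * i * x) * Real.sin (2 * j * x)) := by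
    rw [Finset.sum_comm]
    exact Finset.sum_congr rfl fun i _ => Finset.sum_congr rfl fun j _ => by ring
  simp_rw [hc, mul_sub, Finset.sum_sub_distrib, hanti, sub_self, sub_zero, mul_add,
    Finset.sum_add_distrib, Finset.mul_sum]

theorem oddKernel_nonneg (L : ℕ) {x : ℝ} (hx : |x| ≤ Real.pi / 2) : 0 ≤ oddKernel L x := by
  rw [oddKernel_eq]
  have := Real.cos_nonneg_of_mem_Icc (abs_le.1 hx)
  positivity

theorem oddKernel_nonpos (L : ℕ) {x : ℝ} (hx : Real.pi / 2 ≤ x) (hx' : x ≤ Real.pi) :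
    oddKernel L x ≤ 0 := by
  rw [oddKernel_eq, mul_div_assoc]
  exact mul_nonpos_of_nonpos_of_nonneg
    (Real.cos_nonpos_of_pi_div_two_le_of_le hx (by linarith [Real.pi_pos])) (by positivity)

theorem abs_oddKernel_le_one (L : ℕ) (x : ℝ) : |oddKernel L x| ≤ 1 := by
  rw [oddKernel, abs_div, abs_of_nonneg (by positivity : (0 : ℝ) ≤ (L : ℝ) ^ 2)]
  apply div_le_one_of_le₀ _ (by positivity)
  calc _ ≤ ∑ _i ∈ Finset.range L, ∑ _j ∈ Finset.range L, (1 : ℝ) :=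
        (Finset.abs_sum_le_sum_abs _ _).trans (Finset.sum_le_sum fun i _ =>
          (Finset.abs_sum_le_sum_abs _ _).trans (Finset.sum_le_sum fun j _ =>
            Real.abs_cos_le_one _))
    _ = _ := by simp; ring

theorem abs_oddKernel_le {L : ℕ} {x y : ℝ} (hL : 0 < L) (hy : 0 < y) (h : y ≤ |Real.sin x|) :
    |oddKernel L x| ≤ 1 / (L * y) ^ 2 := by
  have hLR : (0 : ℝ) < L := by exact_mod_cast hL
  set η := Complex.exp ((2 * x : ℝ) * Complex.I) with hη
  have hηn : ‖η‖ = 1 := Complex.norm_exp_ofReal_mul_I _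
  have h1 : ‖1 - η‖ = 2 * |Real.sin x| := by
    have := norm_exp_sub_exp (2 * x) 0
    rw [Complex.ofReal_zero, zero_mul, Complex.exp_zero, ← hη, sub_zero,
      mul_div_cancel_left₀ _ (two_ne_zero)] at this
    rw [norm_sub_rev, this]
  have h2 : ‖∑ j ∈ Finset.range L, η ^ j‖ * y ≤ 1 := by
    have h3 := congrArg norm (mul_neg_geom_sum η L)
    rw [norm_mul, h1] at h3
    have h4 : ‖1 - η ^ L‖ ≤ 2 := by
      refine (norm_sub_le _ _).trans ?_
      rw [norm_pow, hηn]; norm_num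
    have : ‖∑ j ∈ Finset.range L, η ^ j‖ * y ≤ ‖∑ j ∈ Finset.range L, η ^ j‖ * |Real.sin x| := by
      gcongr
    linarith
  have h5 : ‖∑ j ∈ Finset.range L, η ^ j‖ ≤ 1 / y := by rwa [le_div_iff₀ hy]
  rw [oddKernel_eq, abs_div, abs_mul, abs_of_nonneg (by positivity : (0 : ℝ) ≤ (L : ℝ) ^ 2),
    abs_of_nonneg (by positivity : (0 : ℝ) ≤ ‖∑ j ∈ Finset.range L, η ^ j‖ ^ 2)]
  calc _ ≤ 1 * (1 / y) ^ 2 / (L : ℝ) ^ 2 := by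
        gcongr
        exact Real.abs_cos_le_one x
    _ = _ := by field_simp

theorem le_oddKernel {L : ℕ} (hL : 0 < L) {x : ℝ} (hx : 2 * L * |x| ≤ 1) :
    1 / 8 ≤ oddKernel L x := by
  have hLR : (1 : ℝ) ≤ L := by exact_mod_cast hL
  have hx0 := abs_nonneg x
  have hxh : |x| ≤ 1 / 2 := by nlinarith
  have hcos : ∀ y : ℝ, |y| ≤ 1 → 1 / 2 ≤ Real.cos y := by
    intro y hy
    have := Real.one_sub_sq_div_two_le_cos (x := y)
    have := (sq_le_one_iff_abs_le_one y).2 hy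
    linarith
  have h1 := hcos x (by linarith)
  have h2 : (L : ℝ) / 2 ≤ ‖∑ j ∈ Finset.range L, Complex.exp ((2 * x : ℝ) * Complex.I) ^ j‖ := by
    refine le_trans ?_ (Complex.re_le_norm _)
    rw [Complex.re_sum]
    calc (L : ℝ) / 2 = ∑ _j ∈ Finset.range L, (1 / 2 : ℝ) := by simp; ring
      _ ≤ _ := by
        refine Finset.sum_le_sum fun j hj => ?_
        have : Complex.exp ((2 * x : ℝ) * Complex.I) ^ j =
            Complex.exp ((2 * j * x : ℝ) * Complex.I) := by
          rw [← Complex.exp_nat_mul]; push_cast; ring_nf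
        rw [this, Complex.exp_ofReal_mul_I_re]
        apply hcos
        have hj : (j : ℝ) ≤ L := by exact_mod_cast (Finset.mem_range.1 hj).le
        rw [abs_mul, abs_of_nonneg (by positivity : (0 : ℝ) ≤ 2 * j)]
        nlinarith
  rw [oddKernel_eq, le_div_iff₀ (by positivity)]
  calc 1 / 8 * (L : ℝ) ^ 2 = 1 / 2 * ((L : ℝ) / 2) ^ 2 := by ring
    _ ≤ _ := by gcongr

/-- The odd part of a translated kernel. -/
noncomputable def oddBump (L : ℕ) (b θ : ℝ) : ℝ := oddKernel L (θ - b) - oddKernel L (θ + b)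

theorem oddBump_eq (L : ℕ) (b θ : ℝ) : oddBump L b θ =
    2 / (L : ℝ) ^ 2 * ∑ i ∈ Finset.range L, ∑ j ∈ Finset.range L,
      Real.sin (((2 * ((i : ℤ) - j) + 1 : ℤ) : ℝ) * b) *
        Real.sin (((2 * ((i : ℤ) - j) + 1 : ℤ) : ℝ) * θ) := by
  rw [oddBump, oddKernel, oddKernel, ← sub_div, ← Finset.sum_sub_distrib, div_mul_eq_mul_div,
    Finset.mul_sum]
  congr 1
  refine Finset.sum_congr rfl fun i _ => ?_
  rw [← Finset.sum_sub_distrib, Finset.mul_sum]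
  refine Finset.sum_congr rfl fun j _ => ?_
  rw [mul_sub, mul_add, Real.cos_sub, Real.cos_add]
  ring

/-- The number of pairs `i, j < L` with `|2(i - j) + 1| = k`. -/
def oddPairCount (L k : ℕ) : ℕ :=
  ((Finset.range L ×ˢ Finset.range L).filter
    fun x => (2 * ((x.1 : ℤ) - x.2) + 1).natAbs = k).card

theorem oddPairCount_le (L k : ℕ) : oddPairCount L k ≤ 2 * L := by
  classical
  set s := (Finset.range L ×ˢ Finset.range L).filter
    fun x => (2 * ((x.1 : ℤ) - x.2) + 1).natAbs = k with hs
  have hpos := Finset.card_filter_add_card_filter_not (s := s)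
    (fun x => 0 ≤ 2 * ((x.1 : ℤ) - x.2) + 1)
  have h1 : (s.filter fun x => 0 ≤ 2 * ((x.1 : ℤ) - x.2) + 1).card ≤ (Finset.range L).card := by
    refine Finset.card_le_card_of_injOn Prod.fst (fun x hx => ?_) fun x hx y hy hxy => ?_
    · simp [hs] at hx
      simpa using hx.1.1.1
    · simp [hs] at hx hy
      exact Prod.ext hxy (by omega)
  have h2 : (s.filter fun x => ¬ 0 ≤ 2 * ((x.1 : ℤ) - x.2) + 1).card ≤ (Finset.range L).card := by
    refine Finset.card_le_card_of_injOn Prod.fst (fun x hx => ?_) fun x hx y hy hxy => ?_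
    · simp [hs] at hx
      simpa using hx.1.1.1
    · simp [hs] at hx hy
      exact Prod.ext hxy (by omega)
  rw [Finset.card_range] at h1 h2
  change s.card ≤ _
  omega

theorem oddPairCount_eq_zero {L k : ℕ} (hk : Even k) : oddPairCount L k = 0 := by
  rw [oddPairCount, Finset.card_eq_zero, Finset.filter_eq_empty_iff]
  intro x _ h
  obtain ⟨m, hm⟩ := hk
  omega

theorem sum_oddPairs (L : ℕ) (φ : ℤ → ℝ) (hφ : ∀ k, φ (-k) = φ k) :
    ∑ i ∈ Finset.range L, ∑ j ∈ Finset.range L, φ (2 * ((i : ℤ) - j) + 1) =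
      ∑ k ∈ Finset.range (2 * L), (oddPairCount L k : ℝ) * φ k := by
  rw [← Finset.sum_product' (f := fun i j : ℕ => φ (2 * ((i : ℤ) - j) + 1)),
    ← Finset.sum_fiberwise_of_maps_to
      (g := fun x : ℕ × ℕ => (2 * ((x.1 : ℤ) - x.2) + 1).natAbs) (t := Finset.range (2 * L))]
  · refine Finset.sum_congr rfl fun k _ => ?_
    rw [oddPairCount, ← nsmul_eq_mul, ← Finset.sum_const]
    refine Finset.sum_congr rfl fun x hx => ?_
    have := (Finset.mem_filter.1 hx).2
    rcases Int.natAbs_eq_iff.1 this with h | h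
    · rw [h]
    · rw [h, hφ]
  · intro x hx
    rw [Finset.mem_product, Finset.mem_range, Finset.mem_range] at hx
    rw [Finset.mem_range]
    omega

/-- A signed sum of bumps is a sine polynomial with odd frequencies. -/
theorem sum_oddBump_eq (L : ℕ) (B : Finset ℕ) (σ b : ℕ → ℝ) (θ : ℝ) :
    ∑ j ∈ B, σ j * oddBump L (b j) θ = ∑ k ∈ Finset.range (2 * L),
      (2 / (L : ℝ) ^ 2 * oddPairCount L k * ∑ j ∈ B, σ j * Real.sin (k * b j)) *
        Real.sin (k * θ) := by
  have h : ∀ j ∈ B, σ j * oddBump L (b j) θ = ∑ k ∈ Finset.range (2 * L),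
      (2 / (L : ℝ) ^ 2 * oddPairCount L k * (σ j * Real.sin (k * b j))) * Real.sin (k * θ) := by
    intro j _
    rw [oddBump_eq, sum_oddPairs L (fun k => Real.sin ((k : ℝ) * b j) * Real.sin ((k : ℝ) * θ)),
      Finset.mul_sum, Finset.mul_sum]
    · refine Finset.sum_congr rfl fun k _ => ?_
      push_cast
      ring
    · intro k
      push_cast
      rw [neg_mul, neg_mul, Real.sin_neg, Real.sin_neg]; ring
  rw [Finset.sum_congr rfl h, Finset.sum_comm]
  refine Finset.sum_congr rfl fun k _ => ?_
  rw [← Finset.sum_mul, Finset.mul_sum]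

/-! ### Size of a signed sum of bumps -/

theorem sum_inv_sq_le {B : Finset ℕ} {f : ℕ → ℕ} (hf : Set.InjOn f B) {k : ℕ}
    (hk : ∀ j ∈ B, k < f j) : ∑ j ∈ B, ((f j : ℝ) ^ 2)⁻¹ ≤ 2 / (k + 1) := by
  classical
  rw [← Finset.sum_image (f := fun n : ℕ => ((n : ℝ) ^ 2)⁻¹) hf]
  refine le_trans ?_ (sum_Ioo_inv_sq_le k ((B.image f).sup id + 1))
  refine Finset.sum_le_sum_of_subset_of_nonneg (fun n hn => ?_) fun _ _ _ => by positivity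
  rw [Finset.mem_Ioo]
  refine ⟨?_, Nat.lt_succ_of_le (Finset.le_sup (f := id) hn)⟩
  obtain ⟨j, hj, rfl⟩ := Finset.mem_image.1 hn
  exact hk j hj

theorem half_abs_le_abs_sin {x : ℝ} (hx : |x| ≤ Real.pi / 2) : |x| / 2 ≤ |Real.sin x| := by
  have h1 := Real.mul_abs_le_abs_sin hx
  have h2 : (1 / 2 : ℝ) ≤ 2 / Real.pi := by
    rw [div_le_div_iff₀ (by norm_num) Real.pi_pos]; linarith [Real.pi_le_four]
  nlinarith [abs_nonneg x]

theorem abs_oddBump_le_of_far {L : ℕ} (hL : 0 < L) {b θ : ℝ} (hb : b ∈ Set.Icc 0 (Real.pi / 2))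
    (hθ : θ ∈ Set.Icc 0 (Real.pi / 2)) {d : ℕ} (hd : 0 < d) (h : d ≤ 2 * L * |θ - b|) :
    |oddBump L b θ| ≤ 32 * ((d : ℝ) ^ 2)⁻¹ := by
  have hLR : (0 : ℝ) < L := by exact_mod_cast hL
  have hdR : (0 : ℝ) < d := by exact_mod_cast hd
  obtain ⟨hb0, hb1⟩ := hb
  obtain ⟨hθ0, hθ1⟩ := hθ
  have habs : |θ - b| ≤ Real.pi / 2 := by rw [abs_le]; constructor <;> linarith
  have hs : d / (4 * L) ≤ |Real.sin (θ - b)| := by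
    refine le_trans ?_ (half_abs_le_abs_sin habs)
    rw [div_le_iff₀ (by positivity)]
    linarith
  have hs' : d / (4 * L) ≤ |Real.sin (θ + b)| := by
    refine hs.trans ?_
    have e1 : 0 ≤ Real.sin θ * Real.cos b := mul_nonneg
      (Real.sin_nonneg_of_nonneg_of_le_pi hθ0 (by linarith [Real.pi_pos]))
      (Real.cos_nonneg_of_mem_Icc ⟨by linarith [Real.pi_pos], hb1⟩)
    have e2 : 0 ≤ Real.cos θ * Real.sin b := mul_nonneg
      (Real.cos_nonneg_of_mem_Icc ⟨by linarith [Real.pi_pos], hθ1⟩)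
      (Real.sin_nonneg_of_nonneg_of_le_pi hb0 (by linarith [Real.pi_pos]))
    rw [Real.sin_sub, Real.sin_add, abs_of_nonneg (add_nonneg e1 e2), abs_le]
    constructor <;> linarith
  have hy : (0 : ℝ) < d / (4 * L) := by positivity
  have h1 := abs_oddKernel_le hL hy hs
  have h2 := abs_oddKernel_le hL hy hs'
  have h3 : 1 / (L * (d / (4 * L))) ^ 2 = 16 * ((d : ℝ) ^ 2)⁻¹ := by field_simp; norm_num
  rw [h3] at h1 h2
  have := abs_sub (oddKernel L (θ - b)) (oddKernel L (θ + b))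
  rw [oddBump]
  linarith

theorem oddKernel_add_le {L : ℕ} (hL : 0 < L) {b θ : ℝ} (hb : b ∈ Set.Icc 0 (Real.pi / 2))
    (hθ : θ ∈ Set.Icc 0 (Real.pi / 2)) {d : ℕ} (hd : 0 < d) (h : d ≤ 2 * L * b) :
    oddKernel L (θ + b) ≤ 16 * ((d : ℝ) ^ 2)⁻¹ := by
  have hLR : (0 : ℝ) < L := by exact_mod_cast hL
  have hdR : (0 : ℝ) < d := by exact_mod_cast hd
  obtain ⟨hb0, hb1⟩ := hb
  obtain ⟨hθ0, hθ1⟩ := hθ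
  rcases le_total (Real.pi / 2) (θ + b) with hc | hc
  · exact (oddKernel_nonpos L hc (by linarith)).trans (by positivity)
  · have hs : d / (4 * L) ≤ |Real.sin (θ + b)| := by
      have habs : |θ + b| = θ + b := abs_of_nonneg (by linarith)
      refine le_trans ?_ (half_abs_le_abs_sin (by rwa [habs]))
      rw [habs, div_le_iff₀ (by positivity)]
      nlinarith
    have h1 := abs_oddKernel_le hL (by positivity) hs
    have h3 : 1 / (L * (d / (4 * L))) ^ 2 = 16 * ((d : ℝ) ^ 2)⁻¹ := by field_simp; norm_num
    rw [h3] at h1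
    exact (le_abs_self _).trans h1

/-- The bumps far from the cell of `θ` contribute little. -/
theorem sum_abs_oddBump_far_le {L : ℕ} (hL : 0 < L) (B : Finset ℕ)
    (hB : ∀ j ∈ B, (j : ℝ) / (2 * L) ≤ Real.pi / 2) {θ : ℝ} (hθ : θ ∈ Set.Icc 0 (Real.pi / 2))
    {j₀ : ℕ} (h1 : (j₀ : ℝ) / (2 * L) ≤ θ) (h2 : θ ≤ (j₀ + 1 : ℝ) / (2 * L)) {R : ℕ}
    (hfar : ∀ j ∈ B, j + (R + 1) < j₀ ∨ j₀ + (R + 1) < j) :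
    ∑ j ∈ B, |oddBump L ((j : ℝ) / (2 * L)) θ| ≤ 128 / (R + 1) := by
  have hLR : (0 : ℝ) < L := by exact_mod_cast hL
  rw [div_le_iff₀ (by positivity)] at h1
  rw [le_div_iff₀ (by positivity)] at h2
  have hpt : ∀ j ∈ B, ∀ d : ℕ, 0 < d → (j + d ≤ j₀ ∨ j₀ + 1 + d ≤ j) →
      |oddBump L ((j : ℝ) / (2 * L)) θ| ≤ 32 * ((d : ℝ) ^ 2)⁻¹ := by
    intro j hj d hd hcase
    refine abs_oddBump_le_of_far hL ⟨by positivity, hB j hj⟩ hθ hd ?_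
    have e : 2 * L * |θ - j / (2 * L)| = |θ * (2 * L) - j| := by
      rw [← abs_of_pos (show (0 : ℝ) < 2 * L by positivity), ← abs_mul,
        abs_of_pos (show (0 : ℝ) < 2 * L by positivity)]
      congr 1
      field_simp
    rw [e]
    rcases hcase with h | h
    · have h' : (j : ℝ) + d ≤ j₀ := by exact_mod_cast h
      refine le_trans ?_ (le_abs_self _); linarith
    · have h' : (j₀ : ℝ) + 1 + d ≤ j := by exact_mod_cast h
      refine le_trans ?_ (neg_le_abs _); linarith
  rw [← Finset.sum_filter_add_sum_filter_not B (fun j => j < j₀)]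
  have hlow : ∑ j ∈ B.filter (fun j => j < j₀), |oddBump L ((j : ℝ) / (2 * L)) θ| ≤
      32 * (2 / (R + 1)) := by
    calc _ ≤ ∑ j ∈ B.filter (fun j => j < j₀), 32 * (((j₀ - j : ℕ) : ℝ) ^ 2)⁻¹ := by
          refine Finset.sum_le_sum fun j hj => ?_
          obtain ⟨hj, hlt⟩ := Finset.mem_filter.1 hj
          exact hpt j hj (j₀ - j) (by omega) (by omega)
      _ ≤ _ := by
          rw [← Finset.mul_sum]
          gcongr
          refine sum_inv_sq_le (f := fun j => j₀ - j) (fun j hj k hk hjk => ?_) fun j hj => ?_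
          · have := (Finset.mem_filter.1 hj).2
            have := (Finset.mem_filter.1 hk).2
            dsimp only at hjk; omega
          · obtain ⟨hj, hlt⟩ := Finset.mem_filter.1 hj
            have := hfar j hj; omega
  have hhigh : ∑ j ∈ B.filter (fun j => ¬ j < j₀), |oddBump L ((j : ℝ) / (2 * L)) θ| ≤
      32 * (2 / (R + 1)) := by
    calc _ ≤ ∑ j ∈ B.filter (fun j => ¬ j < j₀), 32 * (((j - j₀ - 1 : ℕ) : ℝ) ^ 2)⁻¹ := by
          refine Finset.sum_le_sum fun j hj => ?_
          obtain ⟨hj, hlt⟩ := Finset.mem_filter.1 hj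
          have := hfar j hj
          exact hpt j hj (j - j₀ - 1) (by omega) (by omega)
      _ ≤ _ := by
          rw [← Finset.mul_sum]
          gcongr
          refine sum_inv_sq_le (f := fun j => j - j₀ - 1) (fun j hj k hk hjk => ?_) fun j hj => ?_
          · obtain ⟨hj, _⟩ := Finset.mem_filter.1 hj
            obtain ⟨hk, _⟩ := Finset.mem_filter.1 hk
            have := hfar j hj
            have := hfar k hk
            dsimp only at hjk; omega
          · obtain ⟨hj, hlt⟩ := Finset.mem_filter.1 hj
            have := hfar j hj; omega
  have : (128 : ℝ) / (R + 1) = 32 * (2 / (R + 1)) + 32 * (2 / (R + 1)) := by ring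
  rw [this]
  exact add_le_add hlow hhigh

theorem abs_oddBump_le_two (L : ℕ) (b θ : ℝ) : |oddBump L b θ| ≤ 2 := by
  have h1 := abs_oddKernel_le_one L (θ - b)
  have h2 := abs_oddKernel_le_one L (θ + b)
  have := abs_sub (oddKernel L (θ - b)) (oddKernel L (θ + b))
  rw [oddBump]; linarith

theorem abs_sum_oddBump_le {L : ℕ} (hL : 0 < L) (B : Finset ℕ)
    (hB : ∀ j ∈ B, (j : ℝ) / (2 * L) ≤ Real.pi / 2) (σ : ℕ → ℝ) (hσ : ∀ j, |σ j| ≤ 1)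
    {θ : ℝ} (hθ : θ ∈ Set.Icc 0 (Real.pi / 2)) :
    |∑ j ∈ B, σ j * oddBump L ((j : ℝ) / (2 * L)) θ| ≤ 140 := by
  have hLR : (0 : ℝ) < L := by exact_mod_cast hL
  set j₀ := ⌊θ * (2 * L)⌋₊ with hj₀
  have h1 : (j₀ : ℝ) / (2 * L) ≤ θ := by
    rw [div_le_iff₀ (by positivity)]
    exact Nat.floor_le (mul_nonneg hθ.1 (by positivity))
  have h2 : θ ≤ (j₀ + 1 : ℝ) / (2 * L) := by
    rw [le_div_iff₀ (by positivity)]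
    exact (Nat.lt_floor_add_one _).le
  have hterm : |∑ j ∈ B, σ j * oddBump L ((j : ℝ) / (2 * L)) θ| ≤
      ∑ j ∈ B, |oddBump L ((j : ℝ) / (2 * L)) θ| := by
    refine (Finset.abs_sum_le_sum_abs _ _).trans (Finset.sum_le_sum fun j _ => ?_)
    rw [abs_mul]
    exact mul_le_of_le_one_left (abs_nonneg _) (hσ j)
  refine hterm.trans ?_
  rw [← Finset.sum_filter_add_sum_filter_not B (fun j => j₀ ≤ j + 1 ∧ j ≤ j₀ + 1)]
  have hnear : ∑ j ∈ B.filter (fun j => j₀ ≤ j + 1 ∧ j ≤ j₀ + 1),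
      |oddBump L ((j : ℝ) / (2 * L)) θ| ≤ 6 := by
    have hcard : (B.filter (fun j => j₀ ≤ j + 1 ∧ j ≤ j₀ + 1)).card ≤ 3 := by
      refine (Finset.card_le_card (t := Finset.Icc (j₀ - 1) (j₀ + 1)) fun j hj => ?_).trans ?_
      · have := (Finset.mem_filter.1 hj).2
        rw [Finset.mem_Icc]; omega
      · rw [Nat.card_Icc]; omega
    calc _ ≤ ∑ j ∈ B.filter (fun j => j₀ ≤ j + 1 ∧ j ≤ j₀ + 1), (2 : ℝ) :=
          Finset.sum_le_sum fun j _ => abs_oddBump_le_two _ _ _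
      _ = (B.filter (fun j => j₀ ≤ j + 1 ∧ j ≤ j₀ + 1)).card * 2 := by
          rw [Finset.sum_const, nsmul_eq_mul]
      _ ≤ (3 : ℕ) * 2 := by gcongr
      _ = 6 := by norm_num
  have hfar := sum_abs_oddBump_far_le hL (B.filter fun j => ¬ (j₀ ≤ j + 1 ∧ j ≤ j₀ + 1))
    (fun j hj => hB j (Finset.mem_filter.1 hj).1) hθ h1 h2 (R := 0) fun j hj => by
      have := (Finset.mem_filter.1 hj).2
      omega
  norm_num at hfar hnear ⊢
  linarith

/-- The signed sum of bumps is bounded below on a cell whose bump it contains, provided that the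
bumps of the opposite sign are far away. The bumps of the same sign only help, because the kernel
is positive on `[-π/2, π/2]`. -/
theorem le_sum_oddBump {L : ℕ} (hL : 0 < L) (B : Finset ℕ)
    (hB : ∀ j ∈ B, (j : ℝ) / (2 * L) ≤ Real.pi / 2) (σ : ℕ → ℝ) (hσ : ∀ j, σ j = 1 ∨ σ j = -1)
    {θ : ℝ} (hθ : θ ∈ Set.Icc 0 (Real.pi / 2)) {j₀ : ℕ} (hj₀ : j₀ ∈ B)
    (h1 : (j₀ : ℝ) / (2 * L) ≤ θ) (h2 : θ ≤ (j₀ + 1 : ℝ) / (2 * L)) {R : ℕ}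
    (hR : ∀ j ∈ B, R < j)
    (hfar : ∀ j ∈ B, σ j = σ j₀ ∨ (j + (R + 1) < j₀ ∨ j₀ + (R + 1) < j)) :
    1 / 8 - 160 / (R + 1) ≤ σ j₀ * ∑ j ∈ B, σ j * oddBump L ((j : ℝ) / (2 * L)) θ := by
  classical
  have hLR : (0 : ℝ) < L := by exact_mod_cast hL
  have hsq : ∀ j, σ j * σ j = 1 := fun j => by rcases hσ j with h | h <;> rw [h] <;> norm_num
  have habs : ∀ j, |σ j| = 1 := fun j => by rcases hσ j with h | h <;> rw [h] <;> norm_num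
  rw [← Finset.sum_filter_add_sum_filter_not B (fun j => σ j = σ j₀), mul_add]
  have hdiff : -(128 / (R + 1 : ℝ)) ≤ σ j₀ * ∑ j ∈ B.filter (fun j => ¬ σ j = σ j₀),
      σ j * oddBump L ((j : ℝ) / (2 * L)) θ := by
    refine neg_le_of_abs_le ?_
    rw [abs_mul, habs, one_mul]
    refine (Finset.abs_sum_le_sum_abs _ _).trans ?_
    refine le_trans (le_of_eq (Finset.sum_congr rfl fun j _ => ?_))
      (sum_abs_oddBump_far_le hL (B.filter fun j => ¬ σ j = σ j₀)
        (fun j hj => hB j (Finset.mem_filter.1 hj).1) hθ h1 h2 fun j hj =>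
          (hfar j (Finset.mem_filter.1 hj).1).resolve_left (Finset.mem_filter.1 hj).2)
    rw [abs_mul, habs, one_mul]
  have hsame : 1 / 8 - 32 / (R + 1 : ℝ) ≤ σ j₀ * ∑ j ∈ B.filter (fun j => σ j = σ j₀),
      σ j * oddBump L ((j : ℝ) / (2 * L)) θ := by
    have e : σ j₀ * ∑ j ∈ B.filter (fun j => σ j = σ j₀),
        σ j * oddBump L ((j : ℝ) / (2 * L)) θ =
        ∑ j ∈ B.filter (fun j => σ j = σ j₀), oddBump L ((j : ℝ) / (2 * L)) θ := by
      rw [Finset.mul_sum]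
      refine Finset.sum_congr rfl fun j hj => ?_
      rw [(Finset.mem_filter.1 hj).2, ← mul_assoc, hsq, one_mul]
    rw [e]
    simp only [oddBump, Finset.sum_sub_distrib]
    have hpos : 1 / 8 ≤ ∑ j ∈ B.filter (fun j => σ j = σ j₀),
        oddKernel L (θ - (j : ℝ) / (2 * L)) := by
      refine le_trans ?_ (Finset.single_le_sum
        (f := fun j : ℕ => oddKernel L (θ - (j : ℝ) / (2 * L))) (fun j hj => ?_)
        (Finset.mem_filter.2 ⟨hj₀, rfl⟩))
      · apply le_oddKernel hL
        rw [abs_of_nonneg (by linarith)]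
        rw [le_div_iff₀ (by positivity)] at h2
        have : 2 * L * (θ - j₀ / (2 * L)) = θ * (2 * L) - j₀ := by field_simp
        rw [this]; linarith
      · apply oddKernel_nonneg
        have hb := hB j (Finset.mem_filter.1 hj).1
        have hb0 : 0 ≤ (j : ℝ) / (2 * L) := by positivity
        obtain ⟨e1, e2⟩ := hθ
        rw [abs_le]; constructor <;> linarith
    have hneg : ∑ j ∈ B.filter (fun j => σ j = σ j₀),
        oddKernel L (θ + (j : ℝ) / (2 * L)) ≤ 16 * (2 / (R + 1)) := by
      calc _ ≤ ∑ j ∈ B.filter (fun j => σ j = σ j₀), 16 * ((j : ℝ) ^ 2)⁻¹ := by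
            refine Finset.sum_le_sum fun j hj => ?_
            have hj := (Finset.mem_filter.1 hj).1
            refine oddKernel_add_le hL ⟨by positivity, hB j hj⟩ hθ
              (Nat.zero_lt_of_lt (hR j hj)) (le_of_eq ?_)
            field_simp
        _ ≤ _ := by
            rw [← Finset.mul_sum]
            gcongr
            exact sum_inv_sq_le (f := fun j => j) (fun _ _ _ _ h => h) fun j hj =>
              hR j (Finset.mem_filter.1 hj).1
    have : (32 : ℝ) / (R + 1) = 16 * (2 / (R + 1)) := by ring
    linarith
  have : (160 : ℝ) / (R + 1) = 128 / (R + 1) + 32 / (R + 1) := by ring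
  linarith

/-! ### Sine polynomials with odd frequencies -/

theorem sum_odd_sin_add_int_mul_pi (S : Finset ℕ) (c : ℕ → ℝ) (hc : ∀ k, Even k → c k = 0)
    (θ : ℝ) (m : ℤ) : ∑ k ∈ S, c k * Real.sin (k * (θ + m * Real.pi)) =
      (-1) ^ m * ∑ k ∈ S, c k * Real.sin (k * θ) := by
  rw [Finset.mul_sum]
  refine Finset.sum_congr rfl fun k _ => ?_
  rcases Nat.even_or_odd k with h | h
  · rw [hc k h]; ring
  · have e : (k : ℝ) * (θ + m * Real.pi) = k * θ + ((k * m : ℤ) : ℝ) * Real.pi := by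
      push_cast; ring
    rw [e, Real.sin_add_int_mul_pi, zpow_mul, zpow_natCast, h.neg_one_pow]
    ring

/-- Cosine sums of even frequencies and sine sums of odd frequencies are determined, up to sign, by
their values on `[0, π/2]`. -/
theorem exists_mem_Icc_eq (n : ℕ) (p q : ℕ → ℝ) (a : ℕ) (S : Finset ℕ) (c : ℕ → ℝ)
    (hc : ∀ k, Even k → c k = 0) (θ : ℝ) : ∃ t ∈ Set.Icc 0 (Real.pi / 2),
      cosPart (polySum n p) (polySum n q) a t = cosPart (polySum n p) (polySum n q) a θ ∧
      |∑ k ∈ S, c k * Real.sin (k * t)| = |∑ k ∈ S, c k * Real.sin (k * θ)| := by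
  have hpi := Real.pi_pos
  set m := ⌊θ / Real.pi⌋ with hm
  have h1 : (m : ℝ) * Real.pi ≤ θ := by
    rw [← le_div_iff₀ hpi]; exact Int.floor_le _
  have h2 : θ < (m + 1) * Real.pi := by
    rw [← div_lt_iff₀ hpi]; exact Int.lt_floor_add_one _
  have hneg : ∀ x : ℝ, ∑ k ∈ S, c k * Real.sin (k * -x) = -∑ k ∈ S, c k * Real.sin (k * x) := by
    intro x
    rw [← Finset.sum_neg_distrib]
    exact Finset.sum_congr rfl fun k _ => by rw [mul_neg, Real.sin_neg, mul_neg]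
  have hone : ∀ m : ℤ, |(-1 : ℝ) ^ m| = 1 := fun m => by simp [abs_zpow]
  rcases le_total (θ - m * Real.pi) (Real.pi / 2) with h | h
  · refine ⟨θ + ((-m : ℤ) : ℝ) * Real.pi, ⟨?_, ?_⟩, cosPart_add_int_mul_pi _ _ _ _ _, ?_⟩
    · push_cast; linarith
    · push_cast; linarith
    · rw [sum_odd_sin_add_int_mul_pi S c hc, abs_mul, hone, one_mul]
  · refine ⟨-θ + ((m + 1 : ℤ) : ℝ) * Real.pi, ⟨?_, ?_⟩, ?_, ?_⟩
    · push_cast; linarith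
    · push_cast; linarith
    · rw [cosPart_add_int_mul_pi, cosPart_polySum_neg]
    · rw [sum_odd_sin_add_int_mul_pi S c hc, abs_mul, hone, one_mul, hneg, abs_neg]

/-- The coefficients of a sine polynomial can be rounded to signs with a uniform error `O(√L)`. -/
theorem exists_sine_rounding {L : ℕ} (hL : 0 < L) (S : Finset ℕ) (hS : S ⊆ Finset.Icc 1 (2 * L))
    (x : ℕ → ℝ) (hx : ∀ k, |x k| ≤ 1) : ∃ ε : ℕ → ℝ, (∀ k, ε k = 1 ∨ ε k = -1) ∧
      ∀ θ : ℝ, |∑ k ∈ S, (ε k - x k) * Real.sin (k * θ)| ≤ 18 * discConst * √L := by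
  classical
  have hLR : (1 : ℝ) ≤ L := by exact_mod_cast hL
  have hcard : Fintype.card S ≤ 2 * L := by
    rw [Fintype.card_coe]
    refine (Finset.card_le_card hS).trans ?_
    rw [Nat.card_Icc]; omega
  let V : Fin (4 * (2 * L) + 2) → S → ℝ := fun i k =>
    Real.sin ((k : ℕ) * (2 * Real.pi * (i : ℕ) / (4 * (2 * L : ℕ) + 2)))
  obtain ⟨ε, hε, hd⟩ := exists_rounding V (fun i k => Real.abs_sin_le_one _)
    (by rw [Fintype.card_fin]; omega) (fun k => x k) fun k => hx k
  let e : ℕ → ℝ := fun k => if h : k ∈ S then ε ⟨k, h⟩ else 1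
  have he : ∀ k : S, e k = ε k := fun k => by
    simp only [e]; rw [dif_pos k.2]
  refine ⟨e, fun k => ?_, fun θ => ?_⟩
  · by_cases h : k ∈ S
    · rw [he ⟨k, h⟩]; exact hε _
    · left; simp only [e]; rw [dif_neg h]
  have hbound : 3 * discConst * √√((Fintype.card (Fin (4 * (2 * L) + 2)) : ℝ) *
      Fintype.card S) ≤ 9 * discConst * √L := by
    have h1 : √√((Fintype.card (Fin (4 * (2 * L) + 2)) : ℝ) * Fintype.card S) ≤ 3 * √L := by
      rw [Real.sqrt_le_left (by positivity), Real.sqrt_le_left (by positivity), mul_pow,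
        Real.sq_sqrt (by positivity), Fintype.card_fin]
      have h2 : (Fintype.card S : ℝ) ≤ 2 * L := by exact_mod_cast hcard
      calc _ ≤ ((4 * (2 * L) + 2 : ℕ) : ℝ) * (2 * L) := by gcongr
        _ ≤ _ := by push_cast; nlinarith
    have : (0 : ℝ) ≤ discConst := by rw [discConst]; norm_num
    calc _ ≤ 3 * discConst * (3 * √L) := by gcongr
      _ = _ := by ring
  have := abs_sum_sin_le_of_grid (2 * L) S (fun k hk => (Finset.mem_Icc.1 (hS hk)).2)
    (fun k => e k - x k) (Δ := 9 * discConst * √L) (fun i hi => ?_) θ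
  · linarith
  · refine le_trans (le_of_eq ?_) ((hd ⟨i, hi⟩).trans hbound)
    congr 1
    rw [← Finset.sum_coe_sort S]
    refine Finset.sum_congr rfl fun k _ => ?_
    rw [he]
    simp only [V]
    ring

/-- Signs constant on blocks, chosen so that the sine polynomial of the signed bumps has small
coefficients. -/
theorem exists_block_signs {L N : ℕ} (hN : N ≤ 2 * L) (B : Finset ℕ) (blk : ℕ → ℕ) (b : ℕ → ℝ)
    (hblk : ∀ j ∈ B, blk j < N) (h16 : ∀ v, (B.filter fun j => blk j = v).card ≤ 16) :
    ∃ χ : ℕ → ℝ, (∀ v, χ v = 1 ∨ χ v = -1) ∧ ∀ k < 2 * L,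
      |∑ j ∈ B, χ (blk j) * Real.sin (k * b j)| ≤
        16 * discConst * √√(((2 * L : ℕ) : ℝ) * N) := by
  classical
  let V : Fin (2 * L) → ℕ → ℝ := fun k v =>
    (∑ j ∈ B.filter fun j => blk j = v, Real.sin ((k : ℕ) * b j)) / 16
  obtain ⟨χ, hχ, hd⟩ := exists_colouring V (fun k v => by
    simp only [V]
    rw [abs_div, div_le_one (by norm_num)]
    calc _ ≤ ∑ j ∈ B.filter fun j => blk j = v, (1 : ℝ) :=
          (Finset.abs_sum_le_sum_abs _ _).trans (Finset.sum_le_sum fun j _ =>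
            Real.abs_sin_le_one _)
      _ = (B.filter fun j => blk j = v).card := by simp
      _ ≤ (16 : ℕ) := by exact_mod_cast h16 v
      _ = |16| := by norm_num) (Finset.range N) (by simpa using hN)
  refine ⟨χ, hχ, fun k hk => ?_⟩
  have h := hd ⟨k, hk⟩
  rw [Fintype.card_fin, Finset.card_range] at h
  have e : ∑ j ∈ B, χ (blk j) * Real.sin (k * b j) =
      16 * ∑ v ∈ Finset.range N, V ⟨k, hk⟩ v * χ v := by
    rw [← Finset.sum_fiberwise_of_maps_to (g := blk) (t := Finset.range N)
      (fun j hj => Finset.mem_range.2 (hblk j hj)), Finset.mul_sum]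
    refine Finset.sum_congr rfl fun v _ => ?_
    simp only [V]
    rw [div_mul_eq_mul_div, mul_div_cancel₀ _ (by norm_num), Finset.sum_mul]
    refine Finset.sum_congr rfl fun j hj => ?_
    rw [(Finset.mem_filter.1 hj).2, mul_comm]
  rw [e, abs_mul, abs_of_pos (by norm_num : (0 : ℝ) < 16)]
  linarith

/-- The sine polynomial that is large wherever the cosine part is small: a signed sum of bumps at
the cells on which the cosine part takes a small value, with signs constant on blocks. -/
theorem exists_sine_target {D A ε K : ℝ} (hD : 0 < D) {P Q : ℂ → ℂ} (hPQ : FlatPair D P Q)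
    (hPQ1 : √D ≤ (P 1 + Q 1).re) {a L W : ℕ} (hA : 1 ≤ A) (ha : a = A * D)
    (hW : 43520 ≤ W) (hLW : a * W ≤ L) (hLW' : L ≤ 2 * (a * W)) (hε : ε < 1 / 2)
    (hsmall : 80 * (ε + 4 / A) < (1 / (4 * W : ℝ)) ^ 4) (hK : 0 < K)
    (hKW : 64 * K * discConst * √√(12 / W) ≤ 1) :
    ∃ x : ℕ → ℝ, (∀ k, |x k| ≤ 1) ∧ (∀ k, Even k → x k = 0) ∧
      ∀ θ ∈ Set.Icc 0 (Real.pi / 2),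
        |∑ k ∈ Finset.range (2 * L), x k * Real.sin (k * θ)| ≤ 140 * K * √L ∧
        (|cosPart P Q a θ| ≤ ε * √D →
          K / 16 * √L ≤ |∑ k ∈ Finset.range (2 * L), x k * Real.sin (k * θ)|) := by
  classical
  have ha0 : (0 : ℝ) < a := by rw [ha]; positivity
  have haN : 0 < a := by exact_mod_cast ha0
  have hWR : (43520 : ℝ) ≤ W := by exact_mod_cast hW
  have hLWN : W ≤ L := le_trans (Nat.le_mul_of_pos_left W haN) hLW
  have hL : 0 < L := by omega
  have hLR : (0 : ℝ) < L := by exact_mod_cast hL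
  have hLW1 : (a : ℝ) * W ≤ L := by exact_mod_cast hLW
  have hLW2 : (L : ℝ) ≤ 2 * (a * W) := by exact_mod_cast hLW'
  have hsD : 0 < √D := Real.sqrt_pos.2 hD
  let bad : ℕ → Prop := fun j => ∃ θ ∈ Set.Icc 0 (Real.pi / 2),
    (j : ℝ) / (2 * L) ≤ θ ∧ θ ≤ (j + 1 : ℝ) / (2 * L) ∧ |cosPart P Q a θ| ≤ ε * √D
  -- The separation `2560` makes the error `160 / (R + 1)` of `le_sum_oddBump` equal to `1 / 16`.
  obtain ⟨blk, hblk1, hblk2, hblk3⟩ := exists_blocks (R := 2560) (W := W) (by omega) bad (by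
    intro i s hs hsep hcard
    have hs' : ∀ j : ℕ, ∃ θ : ℝ, j ∈ s → (j : ℝ) ≤ θ * (2 * L) ∧ θ * (2 * L) ≤ j + 1 ∧
        |cosPart P Q a θ| ≤ ε * √D := by
      intro j
      by_cases hj : j ∈ s
      · obtain ⟨θ, _, h1, h2, h3⟩ := (hs j hj).1
        rw [div_le_iff₀ (by positivity)] at h1
        rw [le_div_iff₀ (by positivity)] at h2
        exact ⟨θ, fun _ => ⟨h1, h2, h3⟩⟩
      · exact ⟨0, fun h => absurd h hj⟩
    choose θ hθ using hs'
    have hscale : ∀ i j, |θ i - θ j| = |θ i * (2 * L) - θ j * (2 * L)| / (2 * L) := by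
      intro i j
      rw [← sub_mul, abs_mul, abs_of_pos (by positivity : (0 : ℝ) < 2 * L)]
      field_simp
    refine not_five_separated_small hD hPQ (by linarith : 0 < A) ha
      (by positivity : (0 : ℝ) < 1 / (4 * W)) hsmall hcard θ ?_ ?_ fun j hj => (hθ j hj).2.2
    · have hin : ∀ j ∈ s, (i * W : ℝ) ≤ θ j * (2 * L) ∧ θ j * (2 * L) ≤ i * W + W := by
        intro j hj
        obtain ⟨h1, h2, _⟩ := hθ j hj
        obtain ⟨_, h3, h4⟩ := hs j hj
        have h3' : (i * W : ℝ) ≤ j := by exact_mod_cast h3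
        have h4' : (j + 1 : ℝ) ≤ i * W + W := by
          have : j + 1 ≤ i * W + W := by rw [add_mul, one_mul] at h4; omega
          exact_mod_cast this
        constructor <;> linarith
      intro j hj k hk
      rw [hscale, div_le_div_iff₀ (by positivity) (by positivity)]
      have : |θ j * (2 * L) - θ k * (2 * L)| ≤ W := by
        obtain ⟨h1, h2⟩ := hin j hj
        obtain ⟨h3, h4⟩ := hin k hk
        rw [abs_le]; constructor <;> linarith
      nlinarith
    · intro j hj k hk hjk
      have hge : 1 ≤ |θ j * (2 * L) - θ k * (2 * L)| := by
        obtain ⟨h1, h2, _⟩ := hθ j hj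
        obtain ⟨h3, h4, _⟩ := hθ k hk
        rcases Nat.lt_or_gt_of_ne hjk with h | h
        · have : (j : ℝ) + 2 ≤ k := by exact_mod_cast hsep j hj k hk h
          refine le_trans ?_ (neg_le_abs _); linarith
        · have : (k : ℝ) + 2 ≤ j := by exact_mod_cast hsep k hk j hj h
          refine le_trans ?_ (le_abs_self _); linarith
      rw [hscale, mul_div_assoc', div_le_div_iff₀ (by positivity) (by positivity)]
      have : a * 1 ≤ a * |θ j * (2 * L) - θ k * (2 * L)| := by gcongr
      nlinarith)
  -- Near `0` the cosine part is large, so that no bump interferes with its mirror image there.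
  have hbad0 : ∀ j, bad j → 2559 < j := by
    rintro j ⟨θ, hθ, h1, h2, h3⟩
    by_contra hj
    have hjR : (j : ℝ) + 1 ≤ 2560 := by
      have : j + 1 ≤ 2560 := by omega
      exact_mod_cast this
    rw [le_div_iff₀ (by positivity)] at h2
    have h5 : 34 * (a * θ) ≤ 1 := by
      have : θ * (2 * (a * W)) ≤ 2560 := by
        have := mul_le_mul_of_nonneg_left hLW1 hθ.1
        linarith
      have h6 : 0 ≤ a * θ := mul_nonneg ha0.le hθ.1
      nlinarith
    have := half_sqrt_le_abs_cosPart hD hPQ hPQ1 (by rw [ha]; nlinarith) hθ.1 h5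
    nlinarith
  set B := (Finset.range (4 * L)).filter bad with hBdef
  have hB : ∀ j ∈ B, (j : ℝ) / (2 * L) ≤ Real.pi / 2 := by
    intro j hj
    obtain ⟨θ, hθ, h1, _⟩ := (Finset.mem_filter.1 hj).2
    exact h1.trans hθ.2
  have hdiv : 4 * L / W + 2 ≤ 2 * L := by
    have : 4 * L / W ≤ 4 * L / 4 := Nat.div_le_div_left (by omega) (by norm_num)
    omega
  obtain ⟨χ, hχ, hχd⟩ := exists_block_signs hdiv B blk (fun j => (j : ℝ) / (2 * L))
    (fun j hj => by
      have h1 := hblk1 j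
      have h2 := Finset.mem_range.1 (Finset.mem_filter.1 hj).1
      have : j / W ≤ 4 * L / W := Nat.div_le_div_right h2.le
      omega)
    (fun v => hblk3 v _ fun j hj => by
      obtain ⟨h1, h2⟩ := Finset.mem_filter.1 hj
      exact ⟨(Finset.mem_filter.1 h1).2, h2⟩)
  set σ : ℕ → ℝ := fun j => χ (blk j) with hσ
  have hσ1 : ∀ j, σ j = 1 ∨ σ j = -1 := fun j => hχ _
  have hσabs : ∀ j, |σ j| ≤ 1 := fun j => by rcases hσ1 j with h | h <;> rw [h] <;> norm_num
  set y : ℕ → ℝ := fun k => 2 / (L : ℝ) ^ 2 * oddPairCount L k *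
    ∑ j ∈ B, σ j * Real.sin (k * ((j : ℝ) / (2 * L))) with hy
  have hsum : ∀ θ : ℝ, ∑ k ∈ Finset.range (2 * L),
      (if k < 2 * L then K * √L * y k else 0) * Real.sin (k * θ) =
      K * √L * ∑ j ∈ B, σ j * oddBump L ((j : ℝ) / (2 * L)) θ := by
    intro θ
    rw [sum_oddBump_eq, Finset.mul_sum]
    refine Finset.sum_congr rfl fun k hk => ?_
    rw [if_pos (Finset.mem_range.1 hk)]
    simp only [hy]
    ring
  have hKL : 0 ≤ K * √L := by positivity
  have hdc : (0 : ℝ) ≤ discConst := by rw [discConst]; norm_num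
  refine ⟨fun k => if k < 2 * L then K * √L * y k else 0, fun k => ?_, fun k hk => ?_,
    fun θ hθ => ?_⟩
  · dsimp only
    split_ifs with hk
    swap
    · simp
    have hblocks : √√(((2 * L : ℕ) : ℝ) * ((4 * L / W + 2 : ℕ) : ℝ)) ≤ √L * √√(12 / W) := by
      have e1 : ((4 * L / W + 2 : ℕ) : ℝ) ≤ 6 * L / W := by
        have h1 : ((4 * L / W : ℕ) : ℝ) ≤ ((4 * L : ℕ) : ℝ) / W := Nat.cast_div_le
        have h2 : (2 : ℝ) ≤ 2 * L / W := by
          rw [le_div_iff₀ (by linarith)]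
          have : (W : ℝ) ≤ L := by exact_mod_cast hLWN
          linarith
        push_cast at h1 ⊢
        have : 6 * (L : ℝ) / W = 4 * L / W + 2 * L / W := by ring
        linarith
      have e2 : ((2 * L : ℕ) : ℝ) * ((4 * L / W + 2 : ℕ) : ℝ) ≤ (L : ℝ) ^ 2 * (12 / W) := by
        calc _ ≤ ((2 * L : ℕ) : ℝ) * (6 * L / W) := by gcongr
          _ = _ := by push_cast; ring
      calc _ ≤ √√((L : ℝ) ^ 2 * (12 / W)) := Real.sqrt_le_sqrt (Real.sqrt_le_sqrt e2)
        _ = _ := by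
          rw [Real.sqrt_mul (by positivity), Real.sqrt_sq hLR.le, Real.sqrt_mul hLR.le]
    have hcnt : (oddPairCount L k : ℝ) ≤ 2 * L := by exact_mod_cast oddPairCount_le L k
    simp only [hy]
    rw [abs_mul (K * √L), abs_of_nonneg hKL, abs_mul,
      abs_of_nonneg (by positivity : (0 : ℝ) ≤ 2 / (L : ℝ) ^ 2 * oddPairCount L k)]
    have hs := hχd k hk
    calc _ ≤ K * √L * (2 / (L : ℝ) ^ 2 * (2 * L) * (16 * discConst * (√L * √√(12 / W)))) := by
          gcongr
          exact hs.trans (by gcongr)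
      _ = 64 * K * discConst * √√(12 / W) * (√L ^ 2 / L) := by field_simp; ring
      _ = 64 * K * discConst * √√(12 / W) := by
          rw [Real.sq_sqrt hLR.le, div_self hLR.ne', mul_one]
      _ ≤ 1 := hKW
  · dsimp only
    split_ifs
    · simp only [hy]; rw [oddPairCount_eq_zero hk]; simp
    · rfl
  · rw [hsum, abs_mul, abs_of_nonneg hKL]
    constructor
    · have := abs_sum_oddBump_le hL B hB σ hσabs hθ
      calc _ ≤ K * √L * 140 := by gcongr
        _ = _ := by ring
    · intro hu
      set j₀ := ⌊θ * (2 * L)⌋₊ with hj₀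
      have h1 : (j₀ : ℝ) / (2 * L) ≤ θ := by
        rw [div_le_iff₀ (by positivity)]
        exact Nat.floor_le (mul_nonneg hθ.1 (by positivity))
      have h2 : θ ≤ (j₀ + 1 : ℝ) / (2 * L) := by
        rw [le_div_iff₀ (by positivity)]
        exact (Nat.lt_floor_add_one _).le
      have hj₀B : j₀ ∈ B := by
        refine Finset.mem_filter.2 ⟨Finset.mem_range.2 ?_, θ, hθ, h1, h2, hu⟩
        rw [hj₀, Nat.floor_lt (mul_nonneg hθ.1 (by positivity))]
        push_cast
        have := hθ.2
        have := Real.pi_lt_four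
        nlinarith
      have h3 := le_sum_oddBump hL B hB σ hσ1 hθ hj₀B h1 h2 (R := 2559)
        (fun j hj => hbad0 j (Finset.mem_filter.1 hj).2) fun j hj => by
          by_cases hb : blk j = blk j₀
          · left; simp only [hσ, hb]
          · right
            exact hblk2 j j₀ (Finset.mem_filter.1 hj).2 (Finset.mem_filter.1 hj₀B).2 hb
      have h4 : 1 / 16 ≤ |∑ j ∈ B, σ j * oddBump L ((j : ℝ) / (2 * L)) θ| := by
        have h5 := h3.trans (le_abs_self _)
        rw [abs_mul] at h5
        have h6 := mul_le_of_le_one_left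
          (abs_nonneg (∑ j ∈ B, σ j * oddBump L ((j : ℝ) / (2 * L)) θ)) (hσabs j₀)
        norm_num at h5
        linarith
      calc K / 16 * √L = K * √L * (1 / 16) := by ring
        _ ≤ _ := by gcongr

/-! ### The cosine and sine parts together -/

/-- Signs for the frequencies `1, …, 2L`, split into cosines and sines, such that both parts are
`O(√L)` and they are never small simultaneously. -/
theorem exists_flat_cos_sin : ∃ δ C : ℝ, 0 < δ ∧ 0 < C ∧ ∃ L₀ : ℕ, ∀ L : ℕ, L₀ ≤ L →
    ∃ (S : Finset ℕ) (ε : ℕ → ℝ), S ⊆ Finset.Icc 1 (2 * L) ∧ (∀ k, ε k = 1 ∨ ε k = -1) ∧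
      ∀ θ : ℝ,
        |∑ k ∈ S, ε k * Real.cos (k * θ)| ≤ C * √L ∧
        |∑ k ∈ Finset.Icc 1 (2 * L) \ S, ε k * Real.sin (k * θ)| ≤ C * √L ∧
        (δ * √L ≤ |∑ k ∈ S, ε k * Real.cos (k * θ)| ∨
          δ * √L ≤ |∑ k ∈ Finset.Icc 1 (2 * L) \ S, ε k * Real.sin (k * θ)|) := by
  classical
  -- The constants are chosen in the order `E`, `K`, `W`, `A`, `ε₀`: the rounding error `E`, the bump
  -- height `K` that exceeds it, the window length `W` that makes the blocks few, and the ratio `A`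
  -- and threshold `ε₀` that make small values of the cosine part sparse within each window.
  set E : ℝ := 18 * discConst with hE
  have hE0 : 0 < E := by rw [hE, discConst]; norm_num
  set K : ℝ := 16 * (E + 1) with hK
  have hK0 : 0 < K := by positivity
  obtain ⟨W, hWbig⟩ := exists_nat_ge (max 43520 (12 * (64 * K * discConst) ^ 4))
  have hW1 : (43520 : ℝ) ≤ W := (le_max_left _ _).trans hWbig
  have hW2 : 12 * (64 * K * discConst) ^ 4 ≤ W := (le_max_right _ _).trans hWbig
  have hW0 : (0 : ℝ) < W := by linarith
  have hWN : 43520 ≤ W := by exact_mod_cast hW1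
  have hdc : (0 : ℝ) < discConst := by rw [discConst]; norm_num
  have hKW : 64 * K * discConst * √√(12 / W) ≤ 1 := by
    have hc : 0 < 64 * K * discConst := by positivity
    have : √√(12 / (W : ℝ)) ≤ 1 / (64 * K * discConst) := by
      rw [Real.sqrt_le_left (by positivity), Real.sqrt_le_left (by positivity)]
      rw [← pow_mul, one_div, inv_pow, div_le_iff₀ hW0, ← div_eq_inv_mul,
        le_div_iff₀ (by positivity)]
      exact hW2
    calc _ ≤ 64 * K * discConst * (1 / (64 * K * discConst)) := by gcongr
      _ = 1 := by field_simp
  set h : ℝ := 1 / (4 * W) with hh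
  have hh0 : 0 < h := by positivity
  have hh1 : h ≤ 1 := by rw [hh, div_le_one (by positivity)]; linarith
  obtain ⟨A, hAbig⟩ := exists_nat_ge (max 1 (640 / h ^ 4))
  have hA1 : (1 : ℝ) ≤ A := (le_max_left _ _).trans hAbig
  have hA2 : 640 / h ^ 4 ≤ A := (le_max_right _ _).trans hAbig
  have hAN : 1 ≤ A := by exact_mod_cast hA1
  set ε₀ : ℝ := h ^ 4 / 320 with hε₀
  have hε₀0 : 0 < ε₀ := by positivity
  have hh4 : h ^ 4 ≤ 1 := pow_le_one₀ hh0.le hh1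
  have hsmall : 80 * (ε₀ + 4 / A) < h ^ 4 := by
    have h1 : 640 ≤ A * h ^ 4 := by rwa [div_le_iff₀ (by positivity)] at hA2
    have h2 : 4 / (A : ℝ) ≤ h ^ 4 / 160 := by
      rw [div_le_div_iff₀ (by linarith) (by norm_num)]; linarith
    have h3 : 0 < h ^ 4 := by positivity
    rw [hε₀]; linarith
  set δ : ℝ := min 1 (ε₀ / √(2 * (A * W))) with hδ
  have hAW : (0 : ℝ) < 2 * (A * W) := by positivity
  refine ⟨δ, 140 * K + E + 3, lt_min one_pos (by positivity), by positivity, A * W,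
    fun L hL => ?_⟩
  have hAWN : 0 < A * W := by positivity
  have hL0 : 0 < L := by omega
  have hLR : (0 : ℝ) < L := by exact_mod_cast hL0
  -- The scale `D = 2 ^ t` is the largest power of two with `A * D * W ≤ L`.
  set t := Nat.log 2 (L / (A * W)) with ht
  have hq : L / (A * W) ≠ 0 := (Nat.div_pos hL hAWN).ne'
  have ht1 : 2 ^ t * (A * W) ≤ L :=
    (Nat.mul_le_mul_right _ (Nat.pow_log_le_self 2 hq)).trans (Nat.div_mul_le_self _ _)
  have ht2 : L ≤ 2 * (2 ^ t * (A * W)) := by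
    have h1 : L / (A * W) < 2 ^ (t + 1) := Nat.lt_pow_succ_log_self (by norm_num) _
    have h2 := (Nat.div_lt_iff_lt_mul hAWN).1 h1
    rw [pow_succ] at h2
    linarith
  obtain ⟨p, q, hp, hq, hflat, hone⟩ := exists_rudinShapiro t
  set n := 2 ^ t with hn
  have hn0 : 0 < n := by positivity
  have hnR : (0 : ℝ) < (n : ℝ) := by exact_mod_cast hn0
  set a := A * n with ha
  have han : n ≤ a := Nat.le_mul_of_pos_left n hAN
  have haL : 43520 * a ≤ L := by
    calc 43520 * a ≤ W * a := Nat.mul_le_mul_right _ hWN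
      _ = 2 ^ t * (A * W) := by rw [ha, hn]; ring
      _ ≤ L := ht1
  obtain ⟨x, hx1, hx0, hx⟩ := exists_sine_target hnR hflat hone (a := a) (A := A) (ε := ε₀)
    (L := L) (W := W) hA1 (by rw [ha]; push_cast; ring) hWN
    (by rw [ha]; linarith) (by rw [ha]; linarith) (by rw [hε₀]; linarith) hsmall hK0 hKW
  -- The cosine frequencies, all even: `2(a + j)` and `2(2a + j)` for `j < n`.
  set S₁ := (Finset.range n).image fun j => 2 * (a + j) with hS₁
  set S₂ := (Finset.range n).image fun j => 2 * (2 * a + j) with hS₂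
  set S := S₁ ∪ S₂ with hS
  have hdisj : Disjoint S₁ S₂ := by
    rw [Finset.disjoint_left]
    intro k hk hk'
    obtain ⟨i, hi, rfl⟩ := Finset.mem_image.1 hk
    obtain ⟨j, hj, hij⟩ := Finset.mem_image.1 hk'
    have := Finset.mem_range.1 hi
    omega
  have hSsub : S ⊆ Finset.Icc 1 (2 * L) := by
    intro k hk
    rw [Finset.mem_Icc]
    rcases Finset.mem_union.1 hk with hk | hk
    · obtain ⟨i, hi, rfl⟩ := Finset.mem_image.1 hk
      have := Finset.mem_range.1 hi
      omega
    · obtain ⟨i, hi, rfl⟩ := Finset.mem_image.1 hk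
      have := Finset.mem_range.1 hi
      omega
  have hSeven : ∀ k ∈ S, Even k := by
    intro k hk
    rcases Finset.mem_union.1 hk with hk | hk
    · obtain ⟨i, hi, rfl⟩ := Finset.mem_image.1 hk
      exact even_two_mul _
    · obtain ⟨i, hi, rfl⟩ := Finset.mem_image.1 hk
      exact even_two_mul _
  obtain ⟨ε', hε', hround⟩ := exists_sine_rounding hL0 (Finset.Icc 1 (2 * L) \ S)
    Finset.sdiff_subset x hx1
  let ε : ℕ → ℝ := fun k => if k ∈ S₁ then p (k / 2 - a) else
    if k ∈ S₂ then q (k / 2 - 2 * a) else ε' k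
  have hcos : ∀ θ : ℝ, ∑ k ∈ S, ε k * Real.cos (k * θ) =
      cosPart (polySum n p) (polySum n q) a θ := by
    intro θ
    rw [cosPart_polySum, hS, Finset.sum_union hdisj]
    congr 1
    · rw [hS₁, Finset.sum_image (fun i _ j _ hij => by omega)]
      refine Finset.sum_congr rfl fun j hj => ?_
      have hmem : 2 * (a + j) ∈ S₁ := Finset.mem_image_of_mem _ hj
      have e : 2 * (a + j) / 2 - a = j := by omega
      simp only [ε, if_pos hmem, e]
    · rw [hS₂, Finset.sum_image (fun i _ j _ hij => by omega)]
      refine Finset.sum_congr rfl fun j hj => ?_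
      have hmem : 2 * (2 * a + j) ∈ S₂ := Finset.mem_image_of_mem _ hj
      have hnot : 2 * (2 * a + j) ∉ S₁ := fun h => (Finset.disjoint_left.1 hdisj) h hmem
      have e : 2 * (2 * a + j) / 2 - 2 * a = j := by omega
      simp only [ε, if_neg hnot, if_pos hmem, e]
  have hsin : ∀ θ : ℝ, ∑ k ∈ Finset.Icc 1 (2 * L) \ S, ε k * Real.sin (k * θ) =
      ∑ k ∈ Finset.range (2 * L), x k * Real.sin (k * θ) +
        ∑ k ∈ Finset.Icc 1 (2 * L) \ S, (ε' k - x k) * Real.sin (k * θ) := by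
    intro θ
    have e1 : ∑ k ∈ Finset.range (2 * L), x k * Real.sin (k * θ) =
        ∑ k ∈ Finset.Icc 1 (2 * L) \ S, x k * Real.sin (k * θ) := by
      have e2 : ∑ k ∈ (Finset.range (2 * L)).filter Odd, x k * Real.sin (k * θ) =
          ∑ k ∈ Finset.range (2 * L), x k * Real.sin (k * θ) := by
        refine Finset.sum_subset (Finset.filter_subset _ _) fun k hk hk' => ?_
        have : Even k := by
          by_contra hodd
          exact hk' (Finset.mem_filter.2 ⟨hk, Nat.not_even_iff_odd.1 hodd⟩)
        rw [hx0 k this, zero_mul]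
      rw [← e2]
      refine Finset.sum_subset (fun k hk => ?_) fun k hk hk' => ?_
      · obtain ⟨h1, h2⟩ := Finset.mem_filter.1 hk
        have h1 := Finset.mem_range.1 h1
        refine Finset.mem_sdiff.2 ⟨Finset.mem_Icc.2 ⟨h2.pos, h1.le⟩, fun hkS => ?_⟩
        exact (Nat.not_even_iff_odd.2 h2) (hSeven k hkS)
      · have : Even k := by
          by_contra hodd
          have hodd := Nat.not_even_iff_odd.1 hodd
          refine hk' (Finset.mem_filter.2 ⟨Finset.mem_range.2 ?_, hodd⟩)
          have h1 := (Finset.mem_Icc.1 (Finset.mem_sdiff.1 hk).1).2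
          obtain ⟨m, hm⟩ := hodd
          omega
        rw [hx0 k this, zero_mul]
    rw [e1, ← Finset.sum_add_distrib]
    refine Finset.sum_congr rfl fun k hk => ?_
    have hkS := (Finset.mem_sdiff.1 hk).2
    have h1 : k ∉ S₁ := fun h => hkS (Finset.mem_union_left _ h)
    have h2 : k ∉ S₂ := fun h => hkS (Finset.mem_union_right _ h)
    simp only [ε, if_neg h1, if_neg h2]
    ring
  have hsL : 0 < √(L : ℝ) := Real.sqrt_pos.2 hLR
  refine ⟨S, ε, hSsub, fun k => ?_, fun θ => ?_⟩
  · simp only [ε]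
    split_ifs
    exacts [hp _, hq _, hε' k]
  obtain ⟨θ', hθ', hu, hg⟩ := exists_mem_Icc_eq n p q a (Finset.range (2 * L)) x hx0 θ
  obtain ⟨hup, hlow⟩ := hx θ' hθ'
  rw [hg] at hup hlow
  rw [hu] at hlow
  have hr := hround θ
  rw [hcos, hsin]
  refine ⟨?_, ?_, ?_⟩
  · refine (abs_cosPart_le hflat a θ).trans ?_
    have hnL : (n : ℝ) ≤ L := by
      have : n ≤ L := by omega
      exact_mod_cast this
    calc 2 * √(2 * n) ≤ 2 * (3 / 2 * √L) := by
          gcongr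
          rw [Real.sqrt_le_left (by positivity), mul_pow, Real.sq_sqrt hLR.le]
          linarith
      _ = 3 * √L := by ring
      _ ≤ _ := by gcongr; nlinarith
  · refine (abs_add_le _ _).trans ((add_le_add hup hr).trans ?_)
    nlinarith
  · by_cases hsm : |cosPart (polySum n p) (polySum n q) a θ| ≤ ε₀ * √n
    · right
      have h1 := hlow hsm
      have h2 : δ ≤ 1 := min_le_left _ _
      have h3 : K / 16 * √L = E * √L + √L := by rw [hK]; ring
      have h4 := abs_sub_abs_le_abs_sub (∑ k ∈ Finset.range (2 * L), x k * Real.sin (k * θ))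
        (-∑ k ∈ Finset.Icc 1 (2 * L) \ S, (ε' k - x k) * Real.sin (k * θ))
      rw [abs_neg, sub_neg_eq_add] at h4
      have h5 : δ * √L ≤ 1 * √L := by gcongr
      linarith
    · left
      refine le_trans ?_ (not_le.1 hsm).le
      have h2 : δ ≤ ε₀ / √(2 * (A * W)) := min_le_right _ _
      have h3 : √(L : ℝ) ≤ √(2 * (A * W)) * √n := by
        rw [← Real.sqrt_mul hAW.le]
        apply Real.sqrt_le_sqrt
        have : (L : ℝ) ≤ 2 * (n * (A * W)) := by exact_mod_cast ht2
        linarith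
      calc δ * √L ≤ ε₀ / √(2 * (A * W)) * (√(2 * (A * W)) * √n) := by gcongr
        _ = ε₀ * √n := by
            have := Real.sqrt_pos.2 hAW
            field_simp

/-! ### Littlewood polynomials -/

theorem exists_isLittlewood (n : ℕ) (a : ℕ → ℝ) (ha : ∀ j, a j = 1 ∨ a j = -1) :
    ∃ P : Polynomial ℂ, IsLittlewood P ∧ P.natDegree = n ∧
      ∀ z, P.eval z = polySum (n + 1) a z := by
  let P : Polynomial ℂ := ∑ j ∈ Finset.range (n + 1), Polynomial.C (a j : ℂ) * Polynomial.X ^ j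
  have hcoeff : ∀ j ≤ n, P.coeff j = a j := by
    intro j hj
    simp only [P, Polynomial.finsetSum_coeff, Polynomial.coeff_C_mul_X_pow]
    rw [Finset.sum_eq_single_of_mem j (Finset.mem_range.2 (by omega))]
    · rw [if_pos rfl]
    · intro k _ hk
      rw [if_neg (Ne.symm hk)]
  have hdeg : P.natDegree = n := by
    refine Polynomial.natDegree_eq_of_le_of_coeff_ne_zero ?_ ?_
    · refine Polynomial.natDegree_sum_le_of_forall_le _ _ fun k hk => ?_
      have := Finset.mem_range.1 hk
      exact (Polynomial.natDegree_C_mul_X_pow_le _ _).trans (by omega)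
    · rw [hcoeff n le_rfl]
      rcases ha n with h | h <;> rw [h] <;> norm_num
  refine ⟨P, fun j hj => ?_, hdeg, fun z => ?_⟩
  · rw [hcoeff j (by omega)]
    rcases ha j with h | h <;> rw [h] <;> simp
  · simp [P, polySum, Polynomial.eval_finsetSum]

/-- The polynomial `z ^ n + ⋯ + z - 1` has no zero on the unit circle: a zero satisfies
`z ^ (n + 1) = 2z - 1`, which forces `|2z - 1| = 1` and so `z = 1`. -/
theorem exists_isLittlewood_ne_zero {n : ℕ} (hn : 2 ≤ n) :
    ∃ P : Polynomial ℂ, IsLittlewood P ∧ P.natDegree = n ∧ ∀ z : ℂ, ‖z‖ = 1 → P.eval z ≠ 0 := by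
  obtain ⟨P, hP, hdeg, heval⟩ := exists_isLittlewood n (fun j => if j = 0 then -1 else 1)
    fun j => by split_ifs <;> simp
  refine ⟨P, hP, hdeg, fun z hz h0 => ?_⟩
  have hsum : P.eval z = ∑ j ∈ Finset.range (n + 1), z ^ j - 2 := by
    rw [heval, polySum, Finset.sum_range_succ', Finset.sum_range_succ']
    simp
    ring
  have hgeom := mul_neg_geom_sum z (n + 1)
  have hS : ∑ j ∈ Finset.range (n + 1), z ^ j = 2 := by
    rw [h0] at hsum; linear_combination -hsum
  rw [hS] at hgeom
  have hpow : z ^ (n + 1) = 2 * z - 1 := by linear_combination hgeom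
  have hnorm : ‖2 * z - 1‖ = 1 := by rw [← hpow, norm_pow, hz, one_pow]
  have h1 : z.re * z.re + z.im * z.im = 1 := by
    have := Complex.sq_norm z
    rw [hz, Complex.normSq_apply] at this; linarith
  have h2 : (2 * z.re - 1) * (2 * z.re - 1) + (2 * z.im) * (2 * z.im) = 1 := by
    have := Complex.sq_norm (2 * z - 1)
    rw [hnorm, Complex.normSq_apply] at this
    simp at this; linarith
  have hre : z.re = 1 := by nlinarith
  have him : z.im = 0 := by
    rw [hre] at h1
    have : z.im * z.im = 0 := by linarith
    exact mul_self_eq_zero.1 this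
  have hz1 : z = 1 := Complex.ext (by simpa using hre) (by simpa using him)
  rw [hz1] at hS
  simp at hS
  have : n + 1 = 2 := by exact_mod_cast hS
  omega

/-- Coefficients of degree at most `4L` that are symmetric about `2L` at distances in `S` and
antisymmetric at the other distances; they are continued by `1`. -/
noncomputable def symmCoeff (L : ℕ) (S : Finset ℕ) (ε : ℕ → ℝ) (j : ℕ) : ℝ :=
  if j < 2 * L then (if 2 * L - j ∈ S then ε (2 * L - j) else -ε (2 * L - j))
  else if j = 2 * L ∨ 4 * L < j then 1 else ε (j - 2 * L)

theorem polySum_symmCoeff (L : ℕ) (S : Finset ℕ) (hS : S ⊆ Finset.Icc 1 (2 * L)) (ε : ℕ → ℝ)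
    (θ : ℝ) : polySum (4 * L + 1) (symmCoeff L S ε) (Complex.exp (θ * Complex.I)) =
      Complex.exp (θ * Complex.I) ^ (2 * L) *
        (⟨1 + 2 * ∑ k ∈ S, ε k * Real.cos (k * θ),
          2 * ∑ k ∈ Finset.Icc 1 (2 * L) \ S, ε k * Real.sin (k * θ)⟩ : ℂ) := by
  set z := Complex.exp (θ * Complex.I) with hz
  have hz0 : z ≠ 0 := Complex.exp_ne_zero _
  set f : ℕ → ℂ := fun j => (symmCoeff L S ε j : ℂ) * z ^ j with hf
  have hsplit : polySum (4 * L + 1) (symmCoeff L S ε) z =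
      f (2 * L) + ∑ k ∈ Finset.Icc 1 (2 * L), (f (2 * L - k) + f (2 * L + k)) := by
    have hIcc : ∀ F : ℕ → ℂ, ∑ k ∈ Finset.Icc 1 (2 * L), F k =
        ∑ k ∈ Finset.range (2 * L), F (k + 1) := by
      intro F
      rw [Finset.range_eq_Ico, Finset.sum_Ico_add' F 0 (2 * L) 1]
      rfl
    rw [hIcc, Finset.sum_add_distrib, polySum, show 4 * L + 1 = 2 * L + (2 * L + 1) by ring,
      Finset.sum_range_add, Finset.sum_range_succ', ← Finset.sum_range_reflect]
    have e : ∀ k ∈ Finset.range (2 * L), f (2 * L - 1 - k) = f (2 * L - (k + 1)) := by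
      intro k _
      congr 1; omega
    rw [Finset.sum_congr rfl e, add_zero]
    ring
  have hexp : ∀ k : ℕ, z ^ k = Real.cos (k * θ) + Real.sin (k * θ) * Complex.I := by
    intro k
    rw [hz, ← Complex.exp_nat_mul, show (k : ℂ) * (θ * Complex.I) = ((k * θ : ℝ) : ℂ) * Complex.I by
      push_cast; ring, Complex.exp_mul_I, Complex.ofReal_cos, Complex.ofReal_sin]
  have hexp' : ∀ k : ℕ, (z ^ k)⁻¹ = Real.cos (k * θ) - Real.sin (k * θ) * Complex.I := by
    intro k
    rw [hz, ← Complex.exp_nat_mul, ← Complex.exp_neg,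
      show -((k : ℂ) * (θ * Complex.I)) = ((-(k * θ) : ℝ) : ℂ) * Complex.I by push_cast; ring,
      Complex.exp_mul_I, ← Complex.ofReal_cos, ← Complex.ofReal_sin, Real.cos_neg, Real.sin_neg]
    push_cast; ring
  have hpair : ∀ k ∈ Finset.Icc 1 (2 * L), f (2 * L - k) + f (2 * L + k) = z ^ (2 * L) *
      (if k ∈ S then ((2 * (ε k * Real.cos (k * θ)) : ℝ) : ℂ)
        else ((2 * (ε k * Real.sin (k * θ)) : ℝ) : ℂ) * Complex.I) := by
    intro k hk
    obtain ⟨hk1, hk2⟩ := Finset.mem_Icc.1 hk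
    have e1 : symmCoeff L S ε (2 * L - k) = if k ∈ S then ε k else -ε k := by
      rw [symmCoeff, if_pos (by omega), show 2 * L - (2 * L - k) = k by omega]
    have e2 : symmCoeff L S ε (2 * L + k) = ε k := by
      rw [symmCoeff, if_neg (by omega), if_neg (by omega), Nat.add_sub_cancel_left]
    simp only [hf]
    rw [e1, e2, pow_sub₀ z hz0 hk2, pow_add, hexp', hexp k]
    split_ifs <;> push_cast <;> ring
  have h0 : f (2 * L) = z ^ (2 * L) := by
    simp only [hf]
    rw [symmCoeff, if_neg (by omega), if_pos (Or.inl rfl)]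
    simp
  rw [hsplit, h0, Finset.sum_congr rfl hpair, ← Finset.mul_sum, ← mul_one_add]
  congr 1
  rw [← Finset.sum_sdiff hS]
  have e1 : ∑ k ∈ Finset.Icc 1 (2 * L) \ S,
      (if k ∈ S then ((2 * (ε k * Real.cos (k * θ)) : ℝ) : ℂ)
        else ((2 * (ε k * Real.sin (k * θ)) : ℝ) : ℂ) * Complex.I) =
      ((2 * ∑ k ∈ Finset.Icc 1 (2 * L) \ S, ε k * Real.sin (k * θ) : ℝ) : ℂ) * Complex.I := by
    rw [Finset.mul_sum, Complex.ofReal_sum, Finset.sum_mul]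
    exact Finset.sum_congr rfl fun k hk => if_neg (Finset.mem_sdiff.1 hk).2
  have e2 : ∑ k ∈ S, (if k ∈ S then ((2 * (ε k * Real.cos (k * θ)) : ℝ) : ℂ)
        else ((2 * (ε k * Real.sin (k * θ)) : ℝ) : ℂ) * Complex.I) =
      ((2 * ∑ k ∈ S, ε k * Real.cos (k * θ) : ℝ) : ℂ) := by
    rw [Finset.mul_sum, Complex.ofReal_sum]
    exact Finset.sum_congr rfl fun k hk => if_pos hk
  rw [e1, e2]
  generalize ∑ k ∈ S, ε k * Real.cos (k * θ) = c
  generalize ∑ k ∈ Finset.Icc 1 (2 * L) \ S, ε k * Real.sin (k * θ) = s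
  apply Complex.ext <;> simp

/-- Flat Littlewood polynomials of all large degrees. The constant term `1` of the real part and the
at most three coefficients beyond degree `4L` are negligible against `√L`. -/
theorem exists_flat_of_large : ∃ c C : ℝ, 0 < c ∧ 0 < C ∧ ∃ N : ℕ, ∀ n : ℕ, N ≤ n →
    ∃ P : Polynomial ℂ, IsLittlewood P ∧ P.natDegree = n ∧ ∀ z : ℂ, ‖z‖ = 1 →
      c * √n ≤ ‖P.eval z‖ ∧ ‖P.eval z‖ ≤ C * √n := by
  obtain ⟨δ, C, hδ, hC, L₀, hmain⟩ := exists_flat_cos_sin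
  obtain ⟨L₁, hL₁⟩ := exists_nat_ge ((4 / δ) ^ 2)
  refine ⟨δ / 3, 4 + 4 * C, by positivity, by positivity, 4 * (L₀ + L₁ + 1), fun n hn => ?_⟩
  set L := n / 4 with hL
  have hLn : 4 * L ≤ n ∧ n ≤ 4 * L + 3 := by omega
  have hL1 : 1 ≤ L := by omega
  have hLR : (1 : ℝ) ≤ L := by exact_mod_cast hL1
  obtain ⟨S, ε, hS, hε, hθ⟩ := hmain L (by omega)
  have hsign : ∀ j, symmCoeff L S ε j = 1 ∨ symmCoeff L S ε j = -1 := by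
    intro j
    rw [symmCoeff]
    split_ifs
    · exact hε _
    · rcases hε (2 * L - j) with h | h <;> rw [h] <;> simp
    · exact Or.inl rfl
    · exact hε _
  obtain ⟨P, hP, hdeg, heval⟩ := exists_isLittlewood n (symmCoeff L S ε) hsign
  refine ⟨P, hP, hdeg, fun z hz => ?_⟩
  obtain ⟨θ, rfl⟩ : ∃ θ : ℝ, Complex.exp (θ * Complex.I) = z :=
    ⟨z.arg, by
      have := Complex.norm_mul_exp_arg_mul_I z
      rwa [hz, Complex.ofReal_one, one_mul] at this⟩
  set z := Complex.exp (θ * Complex.I)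
  obtain ⟨h1, h2, h3⟩ := hθ θ
  set c := ∑ k ∈ S, ε k * Real.cos (k * θ)
  set s := ∑ k ∈ Finset.Icc 1 (2 * L) \ S, ε k * Real.sin (k * θ)
  set w : ℂ := ⟨1 + 2 * c, 2 * s⟩ with hw
  -- At most three coefficients lie beyond degree `4L`.
  have htail : ‖P.eval z - z ^ (2 * L) * w‖ ≤ 3 := by
    rw [heval, ← polySum_symmCoeff L S hS ε θ, polySum, polySum,
      ← Finset.sum_range_add_sum_Ico _ (show 4 * L + 1 ≤ n + 1 by omega), add_sub_cancel_left]
    calc _ ≤ ∑ j ∈ Finset.Ico (4 * L + 1) (n + 1), ‖(symmCoeff L S ε j : ℂ) * z ^ j‖ :=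
          norm_sum_le _ _
      _ = ∑ j ∈ Finset.Ico (4 * L + 1) (n + 1), (1 : ℝ) := by
          refine Finset.sum_congr rfl fun j _ => ?_
          rw [norm_mul, norm_pow, hz]
          rcases hsign j with h | h <;> rw [h] <;> simp
      _ = ((n + 1 - (4 * L + 1) : ℕ) : ℝ) := by simp
      _ ≤ (3 : ℕ) := by
          have : n + 1 - (4 * L + 1) ≤ 3 := by omega
          exact_mod_cast this
      _ = 3 := by norm_num
  have hzw : ‖z ^ (2 * L) * w‖ = ‖w‖ := by rw [norm_mul, norm_pow, hz, one_pow, one_mul]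
  have hsL1 : 1 ≤ √(L : ℝ) := by rwa [Real.one_le_sqrt]
  have hδL : 4 ≤ δ * √L := by
    have : 4 / δ ≤ √L := by
      apply Real.le_sqrt_of_sq_le
      refine hL₁.trans ?_
      have : L₁ ≤ L := by omega
      exact_mod_cast this
    rwa [div_le_iff₀' hδ] at this
  have hre : |1 + 2 * c| ≤ ‖w‖ := Complex.abs_re_le_norm w
  have him : |2 * s| ≤ ‖w‖ := Complex.abs_im_le_norm w
  have hwle : ‖w‖ ≤ |1 + 2 * c| + |2 * s| := Complex.norm_le_abs_re_add_abs_im w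
  have hlow : 2 * (δ * √L) - 1 ≤ ‖w‖ := by
    rcases h3 with h | h
    · have e := abs_sub_abs_le_abs_sub (2 * c) (-1)
      rw [abs_mul, abs_two, abs_neg, abs_one, sub_neg_eq_add, add_comm (2 * c)] at e
      linarith
    · rw [abs_mul, abs_two] at him
      linarith
  have hup : ‖w‖ ≤ 1 + 4 * (C * √L) := by
    have e := abs_add_le 1 (2 * c)
    rw [abs_one, abs_mul, abs_two] at e
    rw [abs_mul, abs_two] at hwle
    linarith
  have hn1 : √(n : ℝ) ≤ 3 * √L := by
    rw [Real.sqrt_le_left (by positivity), mul_pow, Real.sq_sqrt (by linarith)]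
    have : (n : ℝ) ≤ 4 * L + 3 := by exact_mod_cast hLn.2
    linarith
  have hn2 : √(L : ℝ) ≤ √n := by
    apply Real.sqrt_le_sqrt
    have : L ≤ n := by omega
    exact_mod_cast this
  have t1 := norm_sub_norm_le (z ^ (2 * L) * w) (P.eval z)
  have t2 := norm_sub_norm_le (P.eval z) (z ^ (2 * L) * w)
  rw [norm_sub_rev] at t1
  rw [hzw] at t1 t2
  constructor
  · have : δ / 3 * √n ≤ δ / 3 * (3 * √L) := by gcongr
    linarith
  · have : (4 + 4 * C) * √L ≤ (4 + 4 * C) * √n := by gcongr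
    linarith

theorem exists_flat_of_two_le {n : ℕ} (hn : 2 ≤ n) : ∃ P : Polynomial ℂ, IsLittlewood P ∧
    P.natDegree = n ∧ ∃ c C : ℝ, 0 < c ∧ ∀ z : ℂ, ‖z‖ = 1 →
      c * √n ≤ ‖P.eval z‖ ∧ ‖P.eval z‖ ≤ C * √n := by
  obtain ⟨P, hP, hdeg, hne⟩ := exists_isLittlewood_ne_zero hn
  have hn0 : 0 < √(n : ℝ) := Real.sqrt_pos.2 (by exact_mod_cast (by omega : 0 < n))
  have hcomp : IsCompact (Metric.sphere (0 : ℂ) 1) := isCompact_sphere 0 1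
  have hnonempty : (Metric.sphere (0 : ℂ) 1).Nonempty := ⟨1, by simp⟩
  have hcont : ContinuousOn (fun z : ℂ => ‖P.eval z‖) (Metric.sphere 0 1) :=
    P.continuous.norm.continuousOn
  obtain ⟨z₁, hz₁, hmin⟩ := hcomp.exists_isMinOn hnonempty hcont
  obtain ⟨z₂, hz₂, hmax⟩ := hcomp.exists_isMaxOn hnonempty hcont
  refine ⟨P, hP, hdeg, ‖P.eval z₁‖ / √n, ‖P.eval z₂‖ / √n,
    div_pos (norm_pos_iff.2 (hne z₁ (by simpa using hz₁))) hn0, fun z hz => ?_⟩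
  have hzs : z ∈ Metric.sphere (0 : ℂ) 1 := by simpa using hz
  rw [div_mul_cancel₀ _ hn0.ne', div_mul_cancel₀ _ hn0.ne']
  exact ⟨hmin hzs, hmax hzs⟩

theorem theorem1p1 :
    ∃ η₁ η₂ : ℝ, 0 < η₁ ∧ η₁ < η₂ ∧
      ∃ P : ℕ → Polynomial ℂ,
        (∀ n : ℕ, IsLittlewood (P n) ∧ (P n).natDegree = n) ∧
        ∀ n : ℕ, 2 ≤ n → ∀ z : ℂ, ‖z‖ = 1 →
          η₁ * Real.sqrt (n : ℝ) ≤ ‖(P n).eval z‖ ∧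
          ‖(P n).eval z‖ ≤ η₂ * Real.sqrt (n : ℝ) := by
  obtain ⟨c, C, hc, _, N, hlarge⟩ := exists_flat_of_large
  have hall : ∀ n : ℕ, ∃ (P : Polynomial ℂ) (c' C' : ℝ), IsLittlewood P ∧ P.natDegree = n ∧
      0 < c' ∧ (N ≤ n → c' = c ∧ C' = C) ∧ (2 ≤ n → ∀ z : ℂ, ‖z‖ = 1 →
        c' * √n ≤ ‖P.eval z‖ ∧ ‖P.eval z‖ ≤ C' * √n) := by
    intro n
    by_cases hN : N ≤ n
    · obtain ⟨P, hP, hdeg, h⟩ := hlarge n hN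
      exact ⟨P, c, C, hP, hdeg, hc, fun _ => ⟨rfl, rfl⟩, fun _ => h⟩
    · by_cases h2 : 2 ≤ n
      · obtain ⟨P, hP, hdeg, c', C', hc', h⟩ := exists_flat_of_two_le h2
        exact ⟨P, c', C', hP, hdeg, hc', fun h => absurd h hN, fun _ => h⟩
      · obtain ⟨P, hP, hdeg, _⟩ := exists_isLittlewood n (fun _ => 1) fun _ => Or.inl rfl
        exact ⟨P, 1, 1, hP, hdeg, one_pos, fun h => absurd h hN, fun h => absurd h h2⟩
  choose P c' C' hP hdeg hc' heq hbd using hall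
  have hne : (Finset.range (N + 1)).Nonempty := ⟨0, by simp⟩
  set η := (Finset.range (N + 1)).inf' hne c' with hη
  set H := (Finset.range (N + 1)).sup' hne C' with hH
  have hη0 : 0 < η := (Finset.lt_inf'_iff _).2 fun n _ => hc' n
  have hbounds : ∀ n, η ≤ c' n ∧ C' n ≤ H := by
    intro n
    by_cases hN : N ≤ n
    · have hmem : N ∈ Finset.range (N + 1) := by simp
      rw [(heq n hN).1, (heq n hN).2, ← (heq N le_rfl).1, ← (heq N le_rfl).2]
      exact ⟨Finset.inf'_le c' hmem, Finset.le_sup' C' hmem⟩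
    · have hmem : n ∈ Finset.range (N + 1) := Finset.mem_range.2 (by omega)
      exact ⟨Finset.inf'_le c' hmem, Finset.le_sup' C' hmem⟩
  refine ⟨η, max H (η + 1), hη0, lt_of_lt_of_le (lt_add_one η) (le_max_right _ _), P,
    fun n => ⟨hP n, hdeg n⟩, fun n hn z hz => ?_⟩
  obtain ⟨h1, h2⟩ := hbd n hn z hz
  obtain ⟨h3, h4⟩ := hbounds n
  constructor
  · refine le_trans ?_ h1
    gcongr
  · refine h2.trans ?_
    gcongr
    exact h4.trans (le_max_left _ _)
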